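/- Let $p\ge 1$ and $n>p$ be integers, let $q,\theta,s\in\mathbb{R}$ with $\theta>0$, $s>0$ and $2q+np>2$ (in particular, this holds whenever $2q+p>2$), let $\mu\in\mathbb{R}^p$, and let $\Sigma$ be a real symmetric positive definite $p\times p$ matrix. Let $X_1,\dots,X_n$ be random vectors in $\mathbb{R}^p$ whose joint probability density with respect to Lebesgue measure on $(\mathbb{R}^p)^n$ is $$f(x_1,\dots,x_n)=|\Sigma|^{-n/2}\,h\Big(\sum_{i=1}^n (x_i-\mu)'\Sigma^{-1}(x_i-\mu)\Big),\qquad h(z)=\frac{s\,\theta^{\frac{2q+pn-2}{2s}}\,\Gamma\left(\frac{pn}{2}\right)}{\pi^{\frac{pn}{2}}\,\Gamma\left(\frac{2q+pn-2}{2s}\right)}\,z^{q-1}e^{-\theta z^s}$$ (the multivariate Kotz type model). Let $\overline{X}=\frac1n\sum_{i=1}^n X_i$ and let $A=\sum_{i=1}^n (X_i-\overline{X})(X_i-\overline{X})'$ be the associated Kotz–Wishart matrix. Write $|\cdot|$ for the determinant, and for real $a>\frac{p-1}{2}$ let $$\Gamma_p(a)=\int_{B>0} e^{-\operatorname{tr}B}\,|B|^{a-\frac{p+1}{2}}\,\prod_{1\le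 i\le j\le p}db_{ij}$$ be the multivariate gamma function, the integral being over the symmetric positive definite $p\times p$ matrices $B=(b_{ij})$. Then for every real $t>0$ the random variable $|A|^t$ is integrable, and $$E\left(|A|^t\right)=\frac{\theta^{-\frac{tp}{s}}\;\Gamma\left(\frac{2q+np+2tp-2}{2s}\right)\,\Gamma\left(\frac{np}{2}\right)\,\Gamma_p\left(\frac{n-1}{2}+t\right)}{\Gamma\left(\frac{2q+np-2}{2s}\right)\,\Gamma\left(\frac{np+2tp}{2}\right)\,\Gamma_p\left(\frac{n-1}{2}\right)}\;|\Sigma|^t .$$ -/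

import Mathlib

open MeasureTheory
open scoped Matrix

noncomputable section

/-- The symmetric `p × p` matrix whose entries on and above the diagonal are the coordinates
`a i j`, `i ≤ j`. -/
def symMatrixOfUpper {p : ℕ} (a : {ij : Fin p × Fin p // ij.1 ≤ ij.2} → ℝ) :
    Matrix (Fin p) (Fin p) ℝ :=
  Matrix.of fun i j => a ⟨(min i j, max i j), min_le_max⟩

/-- The multivariate gamma function `Γ_p(a) = ∫_{A > 0} etr(-A) |A|^{a - (p+1)/2} (dA)`, where
`A` runs over the positive definite symmetric `p × p` matrices and `(dA)` is Lebesgue measure in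
the `p (p + 1) / 2` entries on and above the diagonal. -/
def multivariateGamma (p : ℕ) (a : ℝ) : ℝ :=
  ∫ x in {x : {ij : Fin p × Fin p // ij.1 ≤ ij.2} → ℝ | (symMatrixOfUpper x).PosDef},
    Real.exp (-(symMatrixOfUpper x).trace) *
      (symMatrixOfUpper x).det ^ (a - ((p : ℝ) + 1) / 2)

/-- The density generator of the multivariate Kotz type model of `n` vectors in `ℝ^p`. -/
def kotzGenerator (n p : ℕ) (q θ s : ℝ) (z : ℝ) : ℝ :=
  s * θ ^ ((2 * q + p * n - 2) / (2 * s)) * Real.Gamma (p * n / 2) /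
      (Real.pi ^ ((p * n : ℝ) / 2) * Real.Gamma ((2 * q + p * n - 2) / (2 * s))) *
    z ^ (q - 1) * Real.exp (-θ * z ^ s)

/-- The joint density of the multivariate Kotz type model with location `m` and scale `S`:
`|S|^{-n/2} h(∑ i, (x i - m)' S⁻¹ (x i - m))`. -/
def kotzDensity {n p : ℕ} (q θ s : ℝ) (m : Fin p → ℝ) (S : Matrix (Fin p) (Fin p) ℝ)
    (x : Fin n → Fin p → ℝ) : ℝ :=
  1 / S.det ^ ((n : ℝ) / 2) *
    kotzGenerator n p q θ s (∑ i, (x i - m) ⬝ᵥ (S⁻¹ *ᵥ (x i - m)))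

/-- The random vectors `X 0, …, X (n - 1)` of `ℝ^p` form a multivariate Kotz type model: their
joint law has density `kotzDensity` with respect to Lebesgue measure on `(ℝ^p)^n`. -/
structure IsKotzModel {Ω : Type*} [MeasurableSpace Ω] (P : Measure Ω) {n p : ℕ} (q θ s : ℝ)
    (m : Fin p → ℝ) (S : Matrix (Fin p) (Fin p) ℝ) (X : Fin n → Ω → Fin p → ℝ) : Prop where
  aemeasurable : ∀ i, AEMeasurable (X i) P
  map_eq : P.map (fun ω i => X i ω) =
    (volume : Measure (Fin n → Fin p → ℝ)).withDensity
      fun x => ENNReal.ofReal (kotzDensity q θ s m S x)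

/-- The sample mean of `x 0, …, x (n - 1)`. -/
def sampleMean {n p : ℕ} (x : Fin n → Fin p → ℝ) : Fin p → ℝ :=
  (n : ℝ)⁻¹ • ∑ i, x i

/-- The matrix of sums of squares and products `∑ i, (x i - x̄) (x i - x̄)'`; for the vectors of a
Kotz type model it is the Kotz-Wishart matrix. -/
def sspMatrix {n p : ℕ} (x : Fin n → Fin p → ℝ) : Matrix (Fin p) (Fin p) ℝ :=
  ∑ i, Matrix.vecMulVec (x i - sampleMean x) (x i - sampleMean x)

end

/-! Write `Σ = L L'` and substitute `x_i = L w_i + μ`. The Jacobian cancels `|Σ|^{-n/2}`, `|A|^t`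
contributes `|Σ|^t`, and the density becomes a function of `ρ = ∑ w_ij²` alone
(`lintegral_det_sspMatrix_standardize`).

Now `|A|^t` is homogeneous of degree `2pt` in `w`. In polar coordinates its integral against any
`k(ρ)` is a constant `C`, independent of `k`, times `∫ r^{np-1+2pt} k(r²) dr`
(`exists_lintegral_homogeneous_mul`). Hence the Kotz moment is the Gaussian moment times a ratio of
two one-dimensional gamma integrals, and `C` need never be computed.

For the Gaussian moment, `A = Y' C Y` with `C` the centering projection, of rank `n - 1`. Taking the
Schur complement at the first column `z` gives `|Y' C Y| = (z' C z) |W' C_z W|`, where `C_z` is a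
projection of rank one less. Induction on the number of columns yields a product of chi-square
moments (`lintegral_det_rpow_mul_exp_neg`). The same Schur complement, applied to the defining
integral of `Γ_p`, gives its product formula (`multivariateGamma_eq_prod`), which identifies the
product of moments as `Γ_p((n-1)/2 + t) / Γ_p((n-1)/2)` up to a power of `π`. -/

/-! ### Schur complements. -/

/-- The Schur complement of the upper left entry of a matrix. -/
noncomputable def schurCompl {p : ℕ} (A : Matrix (Fin (p + 1)) (Fin (p + 1)) ℝ) :
    Matrix (Fin p) (Fin p) ℝ :=
  Matrix.of fun i j => A i.succ j.succ - A i.succ 0 * A 0 j.succ / A 0 0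

/-- One step of Gaussian elimination: clearing the first column with the first row leaves the Schur
complement as the remaining block. -/
theorem det_eq_mul_det_schurCompl {p : ℕ} (A : Matrix (Fin (p + 1)) (Fin (p + 1)) ℝ)
    (h : A 0 0 ≠ 0) : A.det = A 0 0 * (schurCompl A).det := by
  set B : Matrix (Fin (p + 1)) (Fin (p + 1)) ℝ :=
    Matrix.of (Fin.cons (A 0) fun i j => A i.succ j - A i.succ 0 / A 0 0 * A 0 j) with hB
  have hAB : A.det = B.det := by
    refine Matrix.det_eq_of_forall_row_eq_smul_add_const
      (Fin.cons 0 fun i => A i.succ 0 / A 0 0) 0 (by simp) ?_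
    intro i j
    refine Fin.cases ?_ (fun i => ?_) i <;> simp [hB]
  rw [hAB, Matrix.det_succ_column_zero, Fin.sum_univ_succ]
  have h0 : ∀ i : Fin p, B i.succ 0 = 0 := fun i => by simp [hB, h]
  have hS : B.submatrix (Fin.succAbove 0) Fin.succ = schurCompl A := by
    ext i j
    simp [hB, schurCompl]
    ring
  simp only [h0, hS]
  simp [hB]

/-- Completing the square in the variable `x 0`. -/
theorem dotProduct_mulVec_eq_schurCompl {p : ℕ} (A : Matrix (Fin (p + 1)) (Fin (p + 1)) ℝ)
    (hA : A.IsSymm) (h : A 0 0 ≠ 0) (x : Fin (p + 1) → ℝ) :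
    x ⬝ᵥ (A *ᵥ x) = A 0 0 * (x 0 + (∑ j, A 0 (Fin.succ j) * x j.succ) / A 0 0) ^ 2 +
      (fun i => x (Fin.succ i)) ⬝ᵥ (schurCompl A *ᵥ fun i => x (Fin.succ i)) := by
  have hs : ∀ i : Fin p, A i.succ 0 = A 0 i.succ := fun i => hA.apply _ _
  simp only [dotProduct, Matrix.mulVec, Fin.sum_univ_succ, schurCompl, Matrix.of_apply, hs, sub_mul,
    Finset.sum_sub_distrib, mul_sub, mul_add, Finset.sum_add_distrib]
  have h1 : ∑ i : Fin p, x i.succ * ∑ j : Fin p, A 0 i.succ * A 0 j.succ / A 0 0 * x j.succ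
      = (∑ j : Fin p, A 0 j.succ * x j.succ) ^ 2 / A 0 0 := by
    rw [sq, Finset.sum_mul_sum, Finset.sum_div]
    refine Finset.sum_congr rfl fun i _ => ?_
    rw [Finset.sum_div, Finset.mul_sum]
    refine Finset.sum_congr rfl fun j _ => ?_
    ring
  have h2 : ∑ i : Fin p, x i.succ * (A 0 i.succ * x 0) = x 0 * ∑ j : Fin p, A 0 j.succ * x j.succ := by
    rw [Finset.mul_sum]
    exact Finset.sum_congr rfl fun i _ => by ring
  rw [h1, h2]
  field_simp
  ring

theorem schurCompl_isSymm {p : ℕ} {A : Matrix (Fin (p + 1)) (Fin (p + 1)) ℝ} (hA : A.IsSymm) :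
    (schurCompl A).IsSymm := by
  ext i j
  simp only [schurCompl, Matrix.transpose_apply, Matrix.of_apply, hA.apply j.succ i.succ,
    hA.apply 0 j.succ, hA.apply 0 i.succ]
  ring

theorem posDef_iff_schurCompl {p : ℕ} {A : Matrix (Fin (p + 1)) (Fin (p + 1)) ℝ}
    (hA : A.IsSymm) : A.PosDef ↔ 0 < A 0 0 ∧ (schurCompl A).PosDef := by
  have hH : ∀ {m : ℕ} {B : Matrix (Fin m) (Fin m) ℝ}, B.IsSymm → B.IsHermitian := fun h => by
    rw [Matrix.IsHermitian, Matrix.conjTranspose_eq_transpose_of_trivial]; exact h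
  constructor
  · intro h
    have h0 : 0 < A 0 0 := h.diag_pos
    refine ⟨h0, Matrix.PosDef.of_dotProduct_mulVec_pos (hH (schurCompl_isSymm hA)) fun y hy => ?_⟩
    -- This first coordinate makes the completed square vanish, so the form at `x` is the Schur form
    -- at `y`.
    set x : Fin (p + 1) → ℝ := Fin.cons (-(∑ j, A 0 (Fin.succ j) * y j) / A 0 0) y with hx
    have hx0 : x ≠ 0 := fun h => hy (by ext i; simpa [hx] using congrFun h i.succ)
    have := h.dotProduct_mulVec_pos hx0
    rw [star_trivial, dotProduct_mulVec_eq_schurCompl A hA h0.ne'] at this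
    have e : x 0 + (∑ j, A 0 (Fin.succ j) * x j.succ) / A 0 0 = 0 := by simp [hx]; ring
    rw [e] at this
    simpa [hx] using this
  · rintro ⟨h0, h⟩
    refine Matrix.PosDef.of_dotProduct_mulVec_pos (hH hA) fun x hx => ?_
    rw [star_trivial, dotProduct_mulVec_eq_schurCompl A hA h0.ne']
    by_cases hy : (fun i : Fin p => x i.succ) = 0
    · have hx0 : x 0 ≠ 0 := fun h' => hx (by
        ext i; refine Fin.cases h' (fun i => congrFun hy i) i)
      have hy' : ∀ i : Fin p, x i.succ = 0 := fun i => congrFun hy i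
      simp only [hy']
      simp
      positivity
    · have := h.dotProduct_mulVec_pos hy
      rw [star_trivial] at this
      positivity

/-! ### Polar coordinates and homogeneous integrands. -/

theorem lintegral_Ioi_comp_mul_left (f : ℝ → ENNReal) {c : ℝ} (hc : 0 < c) (hf : Measurable f) :
    ∫⁻ r in Set.Ioi 0, f (c * r) = ENNReal.ofReal c⁻¹ * ∫⁻ r in Set.Ioi 0, f r := by
  rw [← lintegral_indicator measurableSet_Ioi, ← lintegral_indicator measurableSet_Ioi]
  have hm : Measurable ((Set.Ioi (0 : ℝ)).indicator f) := hf.indicator measurableSet_Ioi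
  have h1 : ∫⁻ r, (Set.Ioi (0 : ℝ)).indicator f (c * r) =
      ∫⁻ r, (Set.Ioi (0 : ℝ)).indicator f r ∂(Measure.map (c * ·) volume) := by
    rw [lintegral_map hm (measurable_const_mul c)]
  rw [Real.map_volume_mul_left hc.ne', lintegral_smul_measure,
    abs_of_pos (inv_pos.2 hc)] at h1
  rw [smul_eq_mul] at h1
  rw [← h1]
  refine lintegral_congr fun r => ?_
  by_cases hr : 0 < r
  · rw [Set.indicator_of_mem (Set.mem_Ioi.2 hr), Set.indicator_of_mem (Set.mem_Ioi.2 (mul_pos hc hr))]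
  · rw [Set.indicator_of_notMem (by simpa using hr), Set.indicator_of_notMem]
    simpa using mul_nonpos_of_nonneg_of_nonpos hc.le (not_lt.1 hr)

/-- Integration in polar coordinates. -/
theorem lintegral_eq_lintegral_toSphere {E : Type*} [NormedAddCommGroup E] [NormedSpace ℝ E]
    [MeasurableSpace E] [BorelSpace E] [FiniteDimensional ℝ E] [Nontrivial E] (μ : Measure E)
    [μ.IsAddHaarMeasure] (f : E → ENNReal) (hf : Measurable f) :
    ∫⁻ x, f x ∂μ = ∫⁻ w : Metric.sphere (0 : E) 1, ∫⁻ r in Set.Ioi (0 : ℝ),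
      ENNReal.ofReal (r ^ (Module.finrank ℝ E - 1)) * f (r • (w : E)) ∂volume ∂μ.toSphere := by
  set g : Metric.sphere (0 : E) 1 × Set.Ioi (0 : ℝ) → ENNReal :=
    fun z => f ((z.2 : ℝ) • (z.1 : E)) with hg
  have hgm : Measurable g := by
    apply hf.comp
    exact (measurable_subtype_coe.comp measurable_snd).smul
      (measurable_subtype_coe.comp measurable_fst)
  calc
    ∫⁻ x, f x ∂μ = ∫⁻ x : ({(0)}ᶜ : Set E), f x ∂(μ.comap (↑)) := by
      rw [lintegral_subtype_comap (measurableSet_singleton _).compl f, restrict_compl_singleton]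
    _ = ∫⁻ x : ({(0)}ᶜ : Set E), g (homeomorphUnitSphereProd E x) ∂(μ.comap (↑)) := by
      refine lintegral_congr fun x => ?_
      have hx : (‖(x : E)‖) ≠ 0 := norm_ne_zero_iff.2 x.2
      simp [hg, smul_smul, hx]
    _ = ∫⁻ z, g z ∂μ.toSphere.prod (.volumeIoiPow (Module.finrank ℝ E - 1)) :=
      μ.measurePreserving_homeomorphUnitSphereProd.lintegral_comp hgm
    _ = _ := by
      rw [lintegral_prod _ hgm.aemeasurable]
      refine lintegral_congr fun w => ?_
      rw [Measure.volumeIoiPow, lintegral_withDensity_eq_lintegral_mul _ (g := fun r => g (w, r))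
        (by fun_prop) (hgm.comp measurable_prodMk_left),
        ← lintegral_subtype_comap measurableSet_Ioi
          (fun r : ℝ => ENNReal.ofReal (r ^ (Module.finrank ℝ E - 1)) * f (r • (w : E)))]
      rfl

/-- The integral of a homogeneous function times a function of a positive quadratic form. -/
theorem exists_lintegral_homogeneous_mul {E : Type*} [NormedAddCommGroup E] [NormedSpace ℝ E]
    [MeasurableSpace E] [BorelSpace E] [FiniteDimensional ℝ E] [Nontrivial E] (μ : Measure E)
    [μ.IsAddHaarMeasure] (G : E → ENNReal) (hG : Measurable G) (b : ℝ)
    (hGb : ∀ (r : ℝ) (x : E), 0 < r → G (r • x) = ENNReal.ofReal (r ^ b) * G x)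
    (Q : E → ℝ) (hQm : Measurable Q) (hQ : ∀ x, x ≠ 0 → 0 < Q x)
    (hQ2 : ∀ (r : ℝ) (x : E), Q (r • x) = r ^ 2 * Q x) :
    ∃ C : ENNReal, ∀ k : ℝ → ENNReal, Measurable k →
      ∫⁻ x, G x * k (Q x) ∂μ = C * ∫⁻ r in Set.Ioi (0 : ℝ),
        ENNReal.ofReal (r ^ ((Module.finrank ℝ E : ℝ) - 1 + b)) * k (r ^ 2) := by
  set N := Module.finrank ℝ E with hN
  have hNpos : 0 < N := Module.finrank_pos
  set a : ℝ := (N : ℝ) - 1 + b with ha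
  -- On the ray through `w`, rescaling `r` by `c = √(Q w)` turns `Q` into `r²`. It costs `c⁻¹ ^ a`
  -- from the power of `r` and one more `c⁻¹` from `dr`. The constant may be infinite, so no
  -- integrability is needed.
  refine ⟨∫⁻ w : Metric.sphere (0 : E) 1,
    G w * ENNReal.ofReal ((Real.sqrt (Q w))⁻¹ ^ (a + 1)) ∂μ.toSphere, fun k hk => ?_⟩
  have hI : Measurable fun r : ℝ => ENNReal.ofReal (r ^ a) * k (r ^ 2) := by fun_prop
  rw [lintegral_eq_lintegral_toSphere μ _ (by fun_prop), ← lintegral_mul_const _ (by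
    apply Measurable.mul
    · exact hG.comp measurable_subtype_coe
    · exact ENNReal.measurable_ofReal.comp ((((hQm.comp measurable_subtype_coe).sqrt).inv).pow_const _))]
  refine lintegral_congr fun w => ?_
  have hw : (w : E) ≠ 0 := fun h => by simpa [h] using w.2
  have hq := hQ w hw
  set c := Real.sqrt (Q w) with hc
  have hcpos : 0 < c := Real.sqrt_pos.2 hq
  have hc2 : Q w = c ^ 2 := (Real.sq_sqrt hq.le).symm
  rw [mul_assoc]
  have key : ∀ r ∈ Set.Ioi (0 : ℝ), ENNReal.ofReal (r ^ (N - 1)) * (G (r • (w : E)) * k (Q (r • (w : E))))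
      = (G w * ENNReal.ofReal (c⁻¹ ^ a)) * (ENNReal.ofReal ((c * r) ^ a) * k ((c * r) ^ 2)) := by
    intro r hr
    have hr : 0 < r := hr
    rw [hGb r _ hr, hQ2, hc2, ← mul_pow, mul_comm r c, Real.mul_rpow hcpos.le hr.le]
    have e1 : r ^ a = r ^ (N - 1) * r ^ b := by
      rw [ha, Real.rpow_add hr]
      congr 1
      rw [← Real.rpow_natCast, Nat.cast_sub hNpos, Nat.cast_one]
    have e2 : c⁻¹ ^ a * (c ^ a * r ^ a) = r ^ (N - 1) * r ^ b := by
      rw [e1, Real.inv_rpow hcpos.le, inv_mul_cancel_left₀ (Real.rpow_pos_of_pos hcpos a).ne']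
    calc _ = (ENNReal.ofReal (r ^ (N - 1)) * ENNReal.ofReal (r ^ b)) * (G w * k ((c * r) ^ 2)) := by ring
      _ = ENNReal.ofReal (c⁻¹ ^ a * (c ^ a * r ^ a)) * (G w * k ((c * r) ^ 2)) := by
        rw [← ENNReal.ofReal_mul (by positivity), e2]
      _ = _ := by rw [ENNReal.ofReal_mul (by positivity)]; ring
  rw [setLIntegral_congr_fun measurableSet_Ioi key, lintegral_const_mul _ (by fun_prop),
    lintegral_Ioi_comp_mul_left (fun r => ENNReal.ofReal (r ^ a) * k (r ^ 2)) hcpos hI,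
    mul_assoc, ← mul_assoc (ENNReal.ofReal (c⁻¹ ^ a)), ← ENNReal.ofReal_mul (by positivity),
    Real.rpow_add_one (by positivity)]

/-! ### Radial, Gaussian and chi-square integrals. -/

theorem lintegral_Ioi_rpow_mul_exp_neg_mul_rpow {a q b s : ℝ} (hb : 0 < b) (hs : 0 < s)
    (h : 0 < a + 2 * q - 1) :
    ∫⁻ r in Set.Ioi (0 : ℝ), ENNReal.ofReal (r ^ a) *
        ENNReal.ofReal ((r ^ 2) ^ (q - 1) * Real.exp (-b * (r ^ 2) ^ s)) =
      ENNReal.ofReal (b ^ (-(a + 2 * q - 1) / (2 * s)) * (1 / (2 * s)) *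
        Real.Gamma ((a + 2 * q - 1) / (2 * s))) := by
  have hI := integral_rpow_mul_exp_neg_mul_rpow (p := 2 * s) (q := a + 2 * q - 2) (b := b)
    (by positivity) (by linarith) hb
  have e : a + 2 * q - 2 + 1 = a + 2 * q - 1 := by ring
  rw [e] at hI
  rw [← hI, ofReal_integral_eq_lintegral_ofReal]
  · refine setLIntegral_congr_fun measurableSet_Ioi fun r hr => ?_
    have hr : 0 < r := hr
    rw [← ENNReal.ofReal_mul (by positivity), ← mul_assoc, ← Real.rpow_natCast,
      ← Real.rpow_mul hr.le, ← Real.rpow_mul hr.le, ← Real.rpow_add hr]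
    congr 3
    push_cast
    ring_nf
  -- Integrability follows from the known value: a non-integrable function has Bochner integral `0`,
  -- but the value is positive.
  · have hpos : 0 < b ^ (-(a + 2 * q - 1) / (2 * s)) * (1 / (2 * s)) *
        Real.Gamma ((a + 2 * q - 1) / (2 * s)) := by
      have := Real.Gamma_pos_of_pos (s := (a + 2 * q - 1) / (2 * s)) (by positivity)
      positivity
    by_contra hni
    rw [integral_undef hni] at hI
    exact hpos.ne hI
  · filter_upwards [ae_restrict_mem measurableSet_Ioi] with r hr
    have hr : 0 < r := hr
    positivity

theorem lintegral_exp_neg_mul_sum_sq {ι : Type*} [Fintype ι] {b : ℝ} (hb : 0 < b) :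
    ∫⁻ y : ι → ℝ, ENNReal.ofReal (Real.exp (-b * ∑ i, y i ^ 2)) =
      ENNReal.ofReal ((Real.pi / b) ^ ((Fintype.card ι : ℝ) / 2)) := by
  have e : ∀ y : ι → ℝ, Real.exp (-b * ∑ i, y i ^ 2) = ∏ i, Real.exp (-b * y i ^ 2) := fun y => by
    rw [← Real.exp_sum, Finset.mul_sum]
  rw [← ofReal_integral_eq_lintegral_ofReal]
  · simp_rw [e]
    rw [integral_fintype_prod_volume_eq_pow fun x : ℝ => Real.exp (-b * x ^ 2), integral_gaussian,
      Real.sqrt_eq_rpow, ← Real.rpow_natCast, ← Real.rpow_mul (by positivity)]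
    ring_nf
  · simp_rw [e]
    exact Integrable.fintype_prod fun _ => integrable_exp_neg_mul_sq hb
  · exact Filter.Eventually.of_forall fun _ => Real.exp_nonneg _

/-- Polar coordinates with the trivial homogeneous factor reduce every exponent to the same unknown
constant `C`. The exponent `0` is the Gaussian integral and eliminates `C`. -/
theorem lintegral_sum_sq_rpow_mul_exp_neg {ι : Type*} [Fintype ι] [Nonempty ι] {t : ℝ}
    (ht : 0 ≤ t) :
    ∫⁻ y : ι → ℝ, ENNReal.ofReal ((∑ i, y i ^ 2) ^ t * Real.exp (-∑ i, y i ^ 2)) =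
      ENNReal.ofReal (Real.pi ^ ((Fintype.card ι : ℝ) / 2) *
        (Real.Gamma ((Fintype.card ι : ℝ) / 2 + t) / Real.Gamma ((Fintype.card ι : ℝ) / 2))) := by
  set d : ℝ := (Fintype.card ι : ℝ) with hd
  have hdpos : 0 < d := by rw [hd]; exact_mod_cast Fintype.card_pos
  obtain ⟨C, hC⟩ := exists_lintegral_homogeneous_mul (volume : Measure (ι → ℝ)) (fun _ => 1)
    measurable_const 0 (by simp) (fun y => ∑ i, y i ^ 2) (by fun_prop)
    (fun y hy => by
      obtain ⟨i, hi⟩ := Function.ne_iff.1 hy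
      exact Finset.sum_pos' (fun i _ => sq_nonneg _) ⟨i, Finset.mem_univ i, by
        have : y i ≠ 0 := hi
        positivity⟩)
    (fun r y => by simp [mul_pow, Finset.mul_sum])
  rw [Module.finrank_fintype_fun_eq_card, ← hd] at hC
  have R : ∀ u : ℝ, 0 ≤ u →
      ∫⁻ y : ι → ℝ, ENNReal.ofReal ((∑ i, y i ^ 2) ^ u * Real.exp (-∑ i, y i ^ 2)) =
        C * ENNReal.ofReal (1 / 2 * Real.Gamma (d / 2 + u)) := by
    intro u hu
    -- The exponents `u + 1 - 1` and `1` put `z ^ u * exp (-z)` in the form of the radial integral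
    -- with `q = u + 1`, `s = 1`.
    have h1 := hC (fun z => ENNReal.ofReal (z ^ (u + 1 - 1) * Real.exp (-1 * z ^ (1 : ℝ))))
      (by fun_prop)
    rw [lintegral_Ioi_rpow_mul_exp_neg_mul_rpow one_pos one_pos (by linarith)] at h1
    simp only [one_mul, add_sub_cancel_right, Real.rpow_one, neg_mul, Real.one_rpow, mul_one] at h1
    rw [h1]
    congr 4
    ring
  have R0 := R 0 le_rfl
  have G := lintegral_exp_neg_mul_sum_sq (ι := ι) one_pos
  simp only [Real.rpow_zero, one_mul] at R0
  simp only [neg_mul, one_mul, div_one] at G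
  rw [G, ← hd, add_zero] at R0
  have hΓ := Real.Gamma_pos_of_pos (half_pos hdpos)
  have hΓt := Real.Gamma_pos_of_pos (add_pos_of_pos_of_nonneg (half_pos hdpos) ht)
  rw [R t ht, ENNReal.ofReal_mul (p := Real.pi ^ (d / 2)) (by positivity), R0, mul_assoc,
    ← ENNReal.ofReal_mul (by positivity)]
  congr 2
  field_simp

theorem lintegral_comp_mulVec {ι : Type*} [Fintype ι] [DecidableEq ι] {M : Matrix ι ι ℝ}
    (hM : M.det ≠ 0) (f : (ι → ℝ) → ENNReal) (hf : Measurable f) :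
    ∫⁻ y, f (M *ᵥ y) = ENNReal.ofReal |M.det⁻¹| * ∫⁻ y, f y := by
  have h := lintegral_map (μ := volume) hf
    (LinearMap.continuous_of_finiteDimensional (Matrix.toLin' M)).measurable
  rw [Real.map_matrix_volume_pi_eq_smul_volume_pi hM, lintegral_smul_measure, smul_eq_mul] at h
  rw [h]
  rfl

/-- The coordinates with `c i = 0` enter only through the Gaussian factor and integrate out, leaving
a chi-square moment in `d` coordinates. -/
theorem lintegral_indicator_sum_sq_rpow_mul_exp_neg {ι : Type*} [Fintype ι] (c : ι → ℝ)
    (hc : ∀ i, c i = 0 ∨ c i = 1) {d : ℕ} (hd : 0 < d) (hcd : ∑ i, c i = d) {t : ℝ} (ht : 0 ≤ t) :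
    ∫⁻ y : ι → ℝ, ENNReal.ofReal ((∑ i, c i * y i ^ 2) ^ t * Real.exp (-∑ i, y i ^ 2)) =
      ENNReal.ofReal (Real.pi ^ ((Fintype.card ι : ℝ) / 2) *
        (Real.Gamma ((d : ℝ) / 2 + t) / Real.Gamma ((d : ℝ) / 2))) := by
  classical
  have h0 : ∀ i : {i // ¬ c i = 1}, c i = 0 := fun i => (hc i).resolve_right i.2
  have hcard : Fintype.card {i // c i = 1} = d := by
    have : ∑ i, c i = ∑ i, if c i = 1 then (1 : ℝ) else 0 :=
      Finset.sum_congr rfl fun i _ => by rcases hc i with h | h <;> simp [h]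
    rw [this, Finset.sum_boole] at hcd
    rw [Fintype.card_subtype]
    exact_mod_cast hcd
  have hne : Nonempty {i // c i = 1} := Fintype.card_pos_iff.1 (hcard ▸ hd)
  have hcard' : Fintype.card {i // ¬ c i = 1} = (Fintype.card ι : ℝ) - d := by
    have := Fintype.card_subtype_compl (fun i => c i = 1)
    rw [this, hcard, Nat.cast_sub (hcard ▸ Fintype.card_subtype_le _)]
  have split : ∀ g : ι → ℝ, ∑ i, g i = ∑ i : {i // c i = 1}, g i + ∑ i : {i // ¬ c i = 1}, g i :=
    fun g => (Fintype.sum_subtype_add_sum_subtype (fun i => c i = 1) g).symm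
  set F : ({i // c i = 1} → ℝ) → ENNReal := fun u =>
    ENNReal.ofReal ((∑ i, u i ^ 2) ^ t * Real.exp (-∑ i, u i ^ 2)) with hF
  set H : ({i // ¬ c i = 1} → ℝ) → ENNReal := fun v =>
    ENNReal.ofReal (Real.exp (-1 * ∑ i, v i ^ 2)) with hH
  have hFm : Measurable F := by fun_prop
  have hHm : Measurable H := by fun_prop
  set K : ({i // c i = 1} → ℝ) × ({i // ¬ c i = 1} → ℝ) → ENNReal := fun z => F z.1 * H z.2 with hK
  have hKm : Measurable K := by fun_prop
  have h1 : ∀ y : ι → ℝ, ENNReal.ofReal ((∑ i, c i * y i ^ 2) ^ t * Real.exp (-∑ i, y i ^ 2)) =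
      K (MeasurableEquiv.piEquivPiSubtypeProd (fun _ : ι => ℝ) (fun i => c i = 1) y) := by
    intro y
    have e1 : ∑ i, c i * y i ^ 2 = ∑ i : {i // c i = 1}, y i ^ 2 := by
      rw [split, Finset.sum_eq_zero (s := (Finset.univ : Finset {i // ¬ c i = 1}))
        (fun i _ => by rw [h0 i, zero_mul]), add_zero]
      exact Finset.sum_congr rfl fun i _ => by rw [i.2, one_mul]
    simp only [hK, hF, hH, MeasurableEquiv.piEquivPiSubtypeProd, MeasurableEquiv.coe_mk,
      Equiv.piEquivPiSubtypeProd_apply]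
    rw [← ENNReal.ofReal_mul (by positivity), e1, split (fun i => y i ^ 2), neg_add, Real.exp_add,
      neg_one_mul, mul_assoc]
  rw [lintegral_congr h1, (volume_preserving_piEquivPiSubtypeProd (fun _ : ι => ℝ) (fun i => c i = 1)).lintegral_comp
    hKm, Measure.volume_eq_prod,
    lintegral_prod_mul hFm.aemeasurable hHm.aemeasurable, hF, hH,
    lintegral_sum_sq_rpow_mul_exp_neg ht, lintegral_exp_neg_mul_sum_sq one_pos, hcard, hcard',
    ← ENNReal.ofReal_mul' (by positivity)]
  congr 1
  have : Real.pi ^ ((Fintype.card ι : ℝ) / 2) =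
      Real.pi ^ ((d : ℝ) / 2) * Real.pi ^ (((Fintype.card ι : ℝ) - d) / 2) := by
    rw [← Real.rpow_add Real.pi_pos]; ring_nf
  rw [this, div_one]
  ring

/-- Moments of a quadratic form with idempotent matrix of trace `d` (a chi-square variable). -/
theorem lintegral_idempotent_rpow_mul_exp_neg {ι : Type*} [Fintype ι] [DecidableEq ι]
    {D : Matrix ι ι ℝ} (hsymm : D.IsSymm) (hD : D * D = D) {d : ℕ} (hd : 0 < d)
    (htr : D.trace = d) {t : ℝ} (ht : 0 ≤ t) :
    ∫⁻ y : ι → ℝ, ENNReal.ofReal ((y ⬝ᵥ (D *ᵥ y)) ^ t * Real.exp (-∑ i, y i ^ 2)) =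
      ENNReal.ofReal (Real.pi ^ ((Fintype.card ι : ℝ) / 2) *
        (Real.Gamma ((d : ℝ) / 2 + t) / Real.Gamma ((d : ℝ) / 2))) := by
  have hH : D.IsHermitian := by
    rw [Matrix.IsHermitian, Matrix.conjTranspose_eq_transpose_of_trivial]; exact hsymm
  set U : Matrix ι ι ℝ := (hH.eigenvectorUnitary : Matrix ι ι ℝ) with hU
  have hUU : Uᵀ * U = 1 := by
    have := Unitary.coe_star_mul_self hH.eigenvectorUnitary
    rwa [Matrix.star_eq_conjTranspose, Matrix.conjTranspose_eq_transpose_of_trivial] at this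
  have hUU' : U * Uᵀ = 1 := mul_eq_one_comm.1 hUU
  have hdiag : Uᵀ * D * U = Matrix.diagonal hH.eigenvalues := by
    have := hH.conjStarAlgAut_star_eigenvectorUnitary
    rw [Unitary.conjStarAlgAut_star_apply, Matrix.star_eq_conjTranspose,
      Matrix.conjTranspose_eq_transpose_of_trivial] at this
    exact this
  -- Idempotence passes to the diagonalisation, so each eigenvalue satisfies `λ² = λ`; their number
  -- equal to `1` is then the trace.
  have hc : ∀ i, hH.eigenvalues i = 0 ∨ hH.eigenvalues i = 1 := by
    intro i
    have h2 : Matrix.diagonal hH.eigenvalues * Matrix.diagonal hH.eigenvalues =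
        Matrix.diagonal hH.eigenvalues := by
      rw [← hdiag]
      calc Uᵀ * D * U * (Uᵀ * D * U) = Uᵀ * D * (U * Uᵀ) * D * U := by
            simp only [Matrix.mul_assoc]
        _ = Uᵀ * D * U := by rw [hUU', Matrix.mul_one, Matrix.mul_assoc Uᵀ, hD]
    rw [Matrix.diagonal_mul_diagonal] at h2
    have h3 := congrFun (Matrix.diagonal_injective h2) i
    rcases eq_or_ne (hH.eigenvalues i) 0 with h | h
    · exact Or.inl h
    · exact Or.inr (mul_left_cancel₀ h (by simpa using h3))
  have hsum : ∑ i, hH.eigenvalues i = d := by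
    rw [← htr, hH.trace_eq_sum_eigenvalues]; rfl
  -- The orthogonal change of variables has Jacobian `1`; it also preserves `∑ i, y i ^ 2`.
  have hdet : |U.det⁻¹| = 1 := by
    have := congrArg Matrix.det hUU
    rw [Matrix.det_mul, Matrix.det_transpose, Matrix.det_one] at this
    have : |U.det| = 1 := by
      rcases mul_self_eq_one_iff.1 this with h | h <;> simp [h]
    rw [abs_inv, this, inv_one]
  have hdet0 : U.det ≠ 0 := fun h => by simp [h] at hdet
  have hm : Measurable fun y : ι → ℝ =>
      ENNReal.ofReal ((y ⬝ᵥ (D *ᵥ y)) ^ t * Real.exp (-∑ i, y i ^ 2)) := by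
    unfold dotProduct Matrix.mulVec dotProduct
    fun_prop
  have key := lintegral_comp_mulVec hdet0 _ hm
  rw [hdet, ENNReal.ofReal_one, one_mul] at key
  rw [← key, ← lintegral_indicator_sum_sq_rpow_mul_exp_neg _ hc hd hsum ht]
  refine lintegral_congr fun y => ?_
  have q : ∀ B : Matrix ι ι ℝ, (U *ᵥ y) ⬝ᵥ (B *ᵥ (U *ᵥ y)) = y ⬝ᵥ ((Uᵀ * B * U) *ᵥ y) := by
    intro B
    rw [← Matrix.mulVec_mulVec, ← Matrix.mulVec_mulVec, Matrix.dotProduct_mulVec y Uᵀ,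
      Matrix.vecMul_transpose]
  have q1 : ∑ i, (U *ᵥ y) i ^ 2 = ∑ i, y i ^ 2 := by
    have := q 1
    rw [Matrix.mul_one, hUU, Matrix.one_mulVec, Matrix.one_mulVec] at this
    simpa [dotProduct, sq] using this
  rw [q, hdiag, q1]
  congr 3
  simp only [dotProduct, Matrix.mulVec_diagonal]
  exact Finset.sum_congr rfl fun i _ => by ring

/-! ### Gaussian determinant moments, one column at a time. -/

/-- Splitting off the first column of a matrix in an integral. -/
theorem lintegral_eq_lintegral_cons {ι : Type*} [Fintype ι] {p : ℕ}
    (f : (ι → Fin (p + 1) → ℝ) → ENNReal) (hf : Measurable f) :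
    ∫⁻ Y, f Y = ∫⁻ z : ι → ℝ, ∫⁻ W : ι → Fin p → ℝ, f fun i => Fin.cons (z i) (W i) := by
  set g : (ι → ℝ) × (ι → Fin p → ℝ) → ENNReal :=
    fun z => f fun i => Fin.cons (z.1 i) (z.2 i) with hg
  have hgm : Measurable g := by
    refine hf.comp (measurable_pi_iff.2 fun i => measurable_pi_iff.2 fun j => ?_)
    refine Fin.cases ?_ (fun j => ?_) j
    · simp only [Fin.cons_zero]
      fun_prop
    · simp only [Fin.cons_succ]
      fun_prop
  have hmp := (volume_measurePreserving_arrowProdEquivProdArrow ℝ (Fin p → ℝ) ι).comp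
    (volume_preserving_pi fun _ : ι =>
      volume_preserving_piFinSuccAbove (fun _ : Fin (p + 1) => ℝ) 0)
  calc ∫⁻ Y, f Y = ∫⁻ Y, g ((MeasurableEquiv.arrowProdEquivProdArrow ℝ (Fin p → ℝ) ι ∘
        fun (Y : ι → Fin (p + 1) → ℝ) i => MeasurableEquiv.piFinSuccAbove (fun _ : Fin (p + 1) => ℝ) 0 (Y i)) Y) := by
        refine lintegral_congr fun Y => ?_
        simp only [hg]
        congr 1
        ext i j
        refine Fin.cases rfl (fun j => rfl) j
    _ = ∫⁻ z, g z := hmp.lintegral_comp hgm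
    _ = _ := by rw [Measure.volume_eq_prod, lintegral_prod _ hgm.aemeasurable]

theorem transpose_mul_mul_apply {ι κ : Type*} [Fintype ι] (C : Matrix ι ι ℝ)
    (Y : Matrix ι κ ℝ) (a b : κ) :
    (Yᵀ * C * Y) a b = (fun i => Y i a) ⬝ᵥ (C *ᵥ fun i => Y i b) := by
  rw [Matrix.mul_assoc]
  rfl

/-- For a projection `C`, `Yᵀ C Y` is the Gram matrix of `C Y`. -/
theorem det_transpose_mul_mul_nonneg {ι κ : Type*} [Fintype ι] [Fintype κ] [DecidableEq κ]
    {C : Matrix ι ι ℝ} (hsymm : C.IsSymm) (hC : C * C = C) (Y : Matrix ι κ ℝ) :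
    0 ≤ (Yᵀ * C * Y).det := by
  have h := (Matrix.posSemidef_conjTranspose_mul_self (C * Y)).det_nonneg
  rw [Matrix.conjTranspose_eq_transpose_of_trivial, Matrix.transpose_mul, hsymm.eq,
    Matrix.mul_assoc, ← Matrix.mul_assoc C, hC, ← Matrix.mul_assoc] at h
  exact h

/-- The idempotent matrix obtained from `C` by removing the direction `C z`. -/
noncomputable def deflate {ι : Type*} [Fintype ι] (C : Matrix ι ι ℝ) (z : ι → ℝ) :
    Matrix ι ι ℝ :=
  C - (z ⬝ᵥ (C *ᵥ z))⁻¹ • Matrix.vecMulVec (C *ᵥ z) (C *ᵥ z)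

section Deflate

variable {ι : Type*} [Fintype ι] {C : Matrix ι ι ℝ} {z : ι → ℝ}

theorem dotProduct_mulVec_comm_of_isSymm (hsymm : C.IsSymm) (v w : ι → ℝ) :
    v ⬝ᵥ (C *ᵥ w) = (C *ᵥ v) ⬝ᵥ w := by
  rw [Matrix.dotProduct_mulVec, ← Matrix.mulVec_transpose, hsymm.eq]

theorem mulVec_dotProduct_mulVec_self (hsymm : C.IsSymm) (hC : C * C = C) (z : ι → ℝ) :
    (C *ᵥ z) ⬝ᵥ (C *ᵥ z) = z ⬝ᵥ (C *ᵥ z) := by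
  rw [← dotProduct_mulVec_comm_of_isSymm hsymm, Matrix.mulVec_mulVec, hC]

theorem deflate_isSymm (hsymm : C.IsSymm) : (deflate C z).IsSymm := by
  unfold deflate
  rw [Matrix.IsSymm, Matrix.transpose_sub, hsymm.eq, Matrix.transpose_smul,
    Matrix.transpose_vecMulVec]

theorem deflate_mul_self (hsymm : C.IsSymm) (hC : C * C = C) (hz : z ⬝ᵥ (C *ᵥ z) ≠ 0) :
    deflate C z * deflate C z = deflate C z := by
  have h1 : C *ᵥ (C *ᵥ z) = C *ᵥ z := by rw [Matrix.mulVec_mulVec, hC]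
  have h2 : (C *ᵥ z) ᵥ* C = C *ᵥ z := by rw [← Matrix.mulVec_transpose, hsymm.eq, h1]
  unfold deflate
  rw [Matrix.sub_mul, Matrix.mul_sub, Matrix.mul_sub, hC, Matrix.mul_smul, Matrix.smul_mul,
    Matrix.mul_vecMulVec, h1, Matrix.vecMulVec_mul, h2, Matrix.smul_mul, Matrix.mul_smul,
    Matrix.vecMulVec_mul_vecMulVec, mulVec_dotProduct_mulVec_self hsymm hC, Matrix.vecMulVec_smul,
    smul_smul (z ⬝ᵥ C *ᵥ z)⁻¹ (z ⬝ᵥ C *ᵥ z), inv_mul_cancel₀ hz, one_smul]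
  simp

/-- The trace of a projection is its rank: removing one direction costs one degree of freedom. -/
theorem deflate_trace (hsymm : C.IsSymm) (hC : C * C = C) (hz : z ⬝ᵥ (C *ᵥ z) ≠ 0) :
    (deflate C z).trace = C.trace - 1 := by
  unfold deflate
  rw [Matrix.trace_sub, Matrix.trace_smul, Matrix.trace_vecMulVec,
    mulVec_dotProduct_mulVec_self hsymm hC, smul_eq_mul, inv_mul_cancel₀ hz]

/-- The Schur complement of `Yᵀ C Y` at its corner `z' C z` is again such a matrix, for the
remaining columns and the deflated projection. -/
theorem det_transpose_mul_mul_cons (hsymm : C.IsSymm) {p : ℕ} (hz : z ⬝ᵥ (C *ᵥ z) ≠ 0)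
    (W : ι → Fin p → ℝ) :
    ((Matrix.of fun i => Fin.cons (z i) (W i) : Matrix ι (Fin (p + 1)) ℝ)ᵀ * C *
      (Matrix.of fun i => Fin.cons (z i) (W i) : Matrix ι (Fin (p + 1)) ℝ)).det =
      (z ⬝ᵥ (C *ᵥ z)) * ((Matrix.of W)ᵀ * deflate C z * Matrix.of W).det := by
  have h0 : ((Matrix.of fun i => Fin.cons (z i) (W i) : Matrix ι (Fin (p + 1)) ℝ)ᵀ * C *
      (Matrix.of fun i => Fin.cons (z i) (W i) : Matrix ι (Fin (p + 1)) ℝ)) 0 0 =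
      z ⬝ᵥ (C *ᵥ z) := by
    rw [transpose_mul_mul_apply]
    simp
  rw [det_eq_mul_det_schurCompl _ (by rw [h0]; exact hz), h0]
  congr 2
  ext a b
  simp only [schurCompl, Matrix.of_apply, h0]
  simp only [transpose_mul_mul_apply, Matrix.of_apply, Fin.cons_succ, Fin.cons_zero]
  unfold deflate
  rw [Matrix.sub_mulVec, dotProduct_sub, Matrix.smul_mulVec, dotProduct_smul,
    Matrix.vecMulVec_mulVec, dotProduct_smul,
    dotProduct_mulVec_comm_of_isSymm hsymm z]
  simp only [smul_eq_mul, MulOpposite.smul_eq_mul_unop, MulOpposite.unop_op]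
  rw [div_eq_inv_mul]

/-- Since `z' C z = |C z|²`, its vanishing forces `C z = 0`, which kills the first row. -/
theorem det_transpose_mul_mul_cons_eq_zero (hsymm : C.IsSymm) (hC : C * C = C) {p : ℕ}
    (hz : z ⬝ᵥ (C *ᵥ z) = 0) (W : ι → Fin p → ℝ) :
    ((Matrix.of fun i => Fin.cons (z i) (W i) : Matrix ι (Fin (p + 1)) ℝ)ᵀ * C *
      (Matrix.of fun i => Fin.cons (z i) (W i) : Matrix ι (Fin (p + 1)) ℝ)).det = 0 := by
  have hCz : C *ᵥ z = 0 := by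
    rw [← mulVec_dotProduct_mulVec_self hsymm hC] at hz
    exact dotProduct_self_eq_zero.1 hz
  refine Matrix.det_eq_zero_of_row_eq_zero 0 fun b => ?_
  rw [transpose_mul_mul_apply]
  simp only [Matrix.of_apply, Fin.cons_zero]
  rw [dotProduct_mulVec_comm_of_isSymm hsymm, hCz, zero_dotProduct]

end Deflate

theorem measurable_det_transpose_mul_mul {ι : Type*} [Fintype ι] {p : ℕ} (C : Matrix ι ι ℝ) :
    Measurable fun Y : ι → Fin p → ℝ => ((Matrix.of Y)ᵀ * C * Matrix.of Y).det := by
  refine Continuous.measurable (Continuous.matrix_det ?_)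
  have h : Continuous fun Y : ι → Fin p → ℝ => (Matrix.of Y : Matrix ι (Fin p) ℝ) := continuous_id
  exact (h.matrix_transpose.matrix_mul continuous_const).matrix_mul h

/-- Moments of the determinant of `Yᵀ C Y` for a standard Gaussian matrix `Y`. -/
theorem lintegral_det_rpow_mul_exp_neg {ι : Type*} [Fintype ι] [DecidableEq ι] {t : ℝ}
    (ht : 0 < t) (p : ℕ) : ∀ (C : Matrix ι ι ℝ) (d : ℕ), C.IsSymm → C * C = C → C.trace = d → p ≤ d →
    ∫⁻ Y : ι → Fin p → ℝ, ENNReal.ofReal (((Matrix.of Y)ᵀ * C * Matrix.of Y).det ^ t *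
        Real.exp (-∑ i, ∑ j, Y i j ^ 2)) =
      ENNReal.ofReal (Real.pi ^ ((Fintype.card ι : ℝ) * p / 2) * ∏ j ∈ Finset.range p,
        (Real.Gamma (((d : ℝ) - j) / 2 + t) / Real.Gamma (((d : ℝ) - j) / 2))) := by
  induction p with
  | zero =>
    intro C d _ _ _ _
    rw [lintegral_unique]
    simp [volume_pi, Measure.pi_univ]
  | succ p ih =>
    intro C d hsymm hC htr hpd
    obtain ⟨d, rfl⟩ : ∃ e, d = e + 1 := ⟨d - 1, by omega⟩
    have hm : Measurable fun Y : ι → Fin (p + 1) → ℝ =>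
        ENNReal.ofReal (((Matrix.of Y)ᵀ * C * Matrix.of Y).det ^ t *
          Real.exp (-∑ i, ∑ j, Y i j ^ 2)) := by
      have := measurable_det_transpose_mul_mul (p := p + 1) C
      fun_prop
    rw [lintegral_eq_lintegral_cons _ hm]
    set K : ENNReal := ENNReal.ofReal (Real.pi ^ ((Fintype.card ι : ℝ) * p / 2) *
      ∏ j ∈ Finset.range p,
        (Real.Gamma (((d : ℝ) - j) / 2 + t) / Real.Gamma (((d : ℝ) - j) / 2))) with hK
    have inner : ∀ z : ι → ℝ, ∫⁻ W : ι → Fin p → ℝ, ENNReal.ofReal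
        (((Matrix.of fun i => Fin.cons (z i) (W i) : Matrix ι (Fin (p + 1)) ℝ)ᵀ * C *
          (Matrix.of fun i => Fin.cons (z i) (W i) : Matrix ι (Fin (p + 1)) ℝ)).det ^ t *
          Real.exp (-∑ i, ∑ j, (Fin.cons (z i) (W i) : Fin (p + 1) → ℝ) j ^ 2)) =
        ENNReal.ofReal ((z ⬝ᵥ (C *ᵥ z)) ^ t * Real.exp (-∑ i, z i ^ 2)) * K := by
      intro z
      -- In the degenerate case both sides vanish because `0 ^ t = 0`, which requires `t ≠ 0`.
      by_cases hz : z ⬝ᵥ (C *ᵥ z) = 0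
      · simp only [hz, Real.zero_rpow ht.ne', zero_mul, ENNReal.ofReal_zero]
        rw [lintegral_eq_zero_iff' (by
          exact (hm.comp (measurable_pi_iff.2 fun i => measurable_pi_iff.2 fun j =>
            Fin.cases (by simp) (fun j => by simp; fun_prop) j)).aemeasurable)]
        refine Filter.Eventually.of_forall fun W => ?_
        have := det_transpose_mul_mul_cons_eq_zero (z := z) hsymm hC hz W
        simp [this, Real.zero_rpow ht.ne']
      · have hz0 : 0 ≤ z ⬝ᵥ (C *ᵥ z) := by
          rw [← mulVec_dotProduct_mulVec_self hsymm hC]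
          exact Finset.sum_nonneg fun i _ => mul_self_nonneg _
        have hds := deflate_isSymm (z := z) hsymm
        have hdd := deflate_mul_self hsymm hC hz
        rw [hK, ← ih (deflate C z) d hds hdd (by
          rw [deflate_trace hsymm hC hz, htr]; push_cast; ring) (by omega), ← lintegral_const_mul _ (by
            have := measurable_det_transpose_mul_mul (p := p) (deflate C z)
            fun_prop)]
        refine lintegral_congr fun W => ?_
        have h1 := det_transpose_mul_mul_cons (z := z) hsymm hz W
        have hdn := det_transpose_mul_mul_nonneg hds hdd (Matrix.of W)
        rw [h1, ← ENNReal.ofReal_mul (by positivity), Real.mul_rpow hz0 hdn]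
        congr 1
        simp only [Fin.sum_univ_succ, Fin.cons_zero, Fin.cons_succ, Finset.sum_add_distrib, neg_add,
          Real.exp_add]
        ring
    rw [lintegral_congr inner, lintegral_mul_const _ (by
      unfold dotProduct Matrix.mulVec dotProduct
      fun_prop),
      lintegral_idempotent_rpow_mul_exp_neg hsymm hC (Nat.succ_pos d) htr ht.le, hK,
      ← ENNReal.ofReal_mul (by
        have h1 := Real.Gamma_pos_of_pos (s := ((d + 1 : ℕ) : ℝ) / 2) (by positivity)
        have h2 := Real.Gamma_pos_of_pos (s := ((d + 1 : ℕ) : ℝ) / 2 + t) (by positivity)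
        positivity)]
    congr 1
    -- The factor `j = 0` is the chi-square moment of the first column, with `d + 1` degrees of
    -- freedom; the shifted factors are those of the induction hypothesis for `d`.
    rw [Finset.prod_range_succ']
    have e : Real.pi ^ ((Fintype.card ι : ℝ) * ((p + 1 : ℕ) : ℝ) / 2) =
        Real.pi ^ ((Fintype.card ι : ℝ) / 2) * Real.pi ^ ((Fintype.card ι : ℝ) * p / 2) := by
      rw [← Real.rpow_add Real.pi_pos]; push_cast; ring_nf
    have e2 : ∀ j : ℕ, (((d + 1 : ℕ) : ℝ) - ((j + 1 : ℕ) : ℝ)) = (d : ℝ) - j := fun j => by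
      push_cast; ring
    simp only [e, e2, Nat.cast_zero, sub_zero]
    ring

/-! ### The multivariate gamma function as a product. -/

/-- The indices on and above the diagonal. -/
abbrev UpperIdx (p : ℕ) : Type := {ij : Fin p × Fin p // ij.1 ≤ ij.2}

/-- The indices on and above the diagonal, split into the corner, the rest of the first row and the
remaining ones. -/
noncomputable def upperIdxSuccEquiv (p : ℕ) :
    Unit ⊕ (Fin p ⊕ UpperIdx p) ≃ UpperIdx (p + 1) :=
  Equiv.ofBijective
    (Sum.elim (fun _ => ⟨(0, 0), le_rfl⟩) (Sum.elim (fun j => ⟨(0, j.succ), Fin.zero_le _⟩)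
      fun ij => ⟨(ij.1.1.succ, ij.1.2.succ), Fin.succ_le_succ_iff.2 ij.2⟩)) (by
    constructor
    · rintro (a | a | ⟨⟨a, a'⟩, ha⟩) (b | b | ⟨⟨b, b'⟩, hb⟩) h <;>
        simp_all [Fin.ext_iff]
    · rintro ⟨⟨i, j⟩, h⟩
      induction i using Fin.cases with
      | zero =>
        induction j using Fin.cases with
        | zero => exact ⟨Sum.inl (), rfl⟩
        | succ j => exact ⟨Sum.inr (Sum.inl j), rfl⟩
      | succ i =>
        induction j using Fin.cases with
        | zero => exact absurd h (by simp)
        | succ j => exact ⟨Sum.inr (Sum.inr ⟨(i, j), Fin.succ_le_succ_iff.1 h⟩), rfl⟩)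

/-- The corner, the rest of the first row and the remaining entries of a symmetric matrix. -/
def splitUpper {p : ℕ} (x : UpperIdx (p + 1) → ℝ) : ℝ × (Fin p → ℝ) × (UpperIdx p → ℝ) :=
  (x ⟨(0, 0), le_rfl⟩, fun j => x ⟨(0, j.succ), Fin.zero_le _⟩,
    fun ij => x ⟨(ij.1.1.succ, ij.1.2.succ), Fin.succ_le_succ_iff.2 ij.2⟩)

/-- The map only regroups coordinates along `upperIdxSuccEquiv`. -/
theorem measurePreserving_splitUpper (p : ℕ) :
    MeasurePreserving (splitUpper (p := p)) volume volume := by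
  have h1 := (volume_measurePreserving_piCongrLeft (fun _ : UpperIdx (p + 1) => ℝ)
    (upperIdxSuccEquiv p)).symm
  have h2 := volume_measurePreserving_sumPiEquivProdPi
    (fun _ : Unit ⊕ (Fin p ⊕ UpperIdx p) => ℝ)
  have h3 := (volume_preserving_funUnique Unit ℝ).prod
    (volume_measurePreserving_sumPiEquivProdPi (fun _ : Fin p ⊕ UpperIdx p => ℝ))
  exact h3.comp (h2.comp h1)

theorem symMatrixOfUpper_isSymm {p : ℕ} (x : UpperIdx p → ℝ) : (symMatrixOfUpper x).IsSymm := by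
  ext i j
  simp [symMatrixOfUpper, min_comm j i, max_comm j i]

section Split

variable {p : ℕ} (x : UpperIdx (p + 1) → ℝ)

theorem symMatrixOfUpper_zero_zero : symMatrixOfUpper x 0 0 = (splitUpper x).1 := by
  simp [symMatrixOfUpper, splitUpper]

theorem symMatrixOfUpper_zero_succ (j : Fin p) :
    symMatrixOfUpper x 0 j.succ = (splitUpper x).2.1 j := by
  simp [symMatrixOfUpper, splitUpper]

theorem symMatrixOfUpper_succ_succ (i j : Fin p) :
    symMatrixOfUpper x i.succ j.succ = symMatrixOfUpper (splitUpper x).2.2 i j := by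
  simp only [symMatrixOfUpper, splitUpper, Matrix.of_apply]
  congr 2
  rcases le_total i j with h | h
  · simp [h, Fin.succ_le_succ_iff.2 h]
  · simp [h, Fin.succ_le_succ_iff.2 h]

/-- In coordinates, the Schur complement is a translate of the lower block once the first row is
fixed, so translation invariance will apply. -/
theorem schurCompl_symMatrixOfUpper :
    schurCompl (symMatrixOfUpper x) = symMatrixOfUpper ((splitUpper x).2.2 -
      fun ij => (splitUpper x).2.1 ij.1.1 * (splitUpper x).2.1 ij.1.2 / (splitUpper x).1) := by
  ext i j
  rw [schurCompl, Matrix.of_apply, (symMatrixOfUpper_isSymm x).apply 0 i.succ,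
    symMatrixOfUpper_zero_succ, symMatrixOfUpper_zero_succ, symMatrixOfUpper_zero_zero,
    symMatrixOfUpper_succ_succ]
  simp only [symMatrixOfUpper, Matrix.of_apply, Pi.sub_apply]
  rcases le_total i j with h | h
  · simp [h]
  · simp [h, mul_comm]

theorem trace_symMatrixOfUpper_succ :
    (symMatrixOfUpper x).trace = (splitUpper x).1 + (symMatrixOfUpper (splitUpper x).2.2).trace := by
  simp only [Matrix.trace, Matrix.diag_apply, Fin.sum_univ_succ, symMatrixOfUpper_zero_zero,
    symMatrixOfUpper_succ_succ]

end Split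

theorem continuous_symMatrixOfUpper (p : ℕ) :
    Continuous (symMatrixOfUpper : (UpperIdx p → ℝ) → Matrix (Fin p) (Fin p) ℝ) := by
  refine continuous_pi fun i => continuous_pi fun j => ?_
  exact continuous_apply _

/-- The positive definite matrices are the closed positive semidefinite cone intersected with the
open set of nonzero determinant. -/
theorem measurableSet_posDef_symMatrixOfUpper (p : ℕ) :
    MeasurableSet {x : UpperIdx p → ℝ | (symMatrixOfUpper x).PosDef} := by
  have e : {x : UpperIdx p → ℝ | (symMatrixOfUpper x).PosDef} =
      (⋂ y : Fin p → ℝ, {x | 0 ≤ y ⬝ᵥ (symMatrixOfUpper x *ᵥ y)}) ∩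
        {x | (symMatrixOfUpper x).det ≠ 0} := by
    ext x
    simp only [Set.mem_ofPred_eq, Set.mem_inter_iff, Set.mem_iInter]
    constructor
    · exact fun h => ⟨fun y => by simpa using h.posSemidef.dotProduct_mulVec_nonneg y, h.det_pos.ne'⟩
    · rintro ⟨h1, h2⟩
      refine (Matrix.PosSemidef.posDef_iff_det_ne_zero ?_).2 h2
      refine Matrix.PosSemidef.of_dotProduct_mulVec_nonneg ?_ (by simpa using h1)
      rw [Matrix.IsHermitian, Matrix.conjTranspose_eq_transpose_of_trivial]
      exact symMatrixOfUpper_isSymm x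
  have hc := continuous_symMatrixOfUpper p
  rw [e]
  refine (isClosed_iInter fun y => isClosed_le continuous_const ?_).measurableSet.inter
    (isOpen_ne_fun hc.matrix_det continuous_const).measurableSet
  exact continuous_const.dotProduct (hc.matrix_mulVec continuous_const)

/-- The integrand of the multivariate gamma function, extended by zero. -/
noncomputable def gammaIntegrand (p : ℕ) (e : ℝ) : (UpperIdx p → ℝ) → ENNReal :=
  {x | (symMatrixOfUpper x).PosDef}.indicator fun x =>
    ENNReal.ofReal (Real.exp (-(symMatrixOfUpper x).trace) * (symMatrixOfUpper x).det ^ e)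

theorem gammaIntegrand_of_posDef {p : ℕ} (e : ℝ) {x : UpperIdx p → ℝ}
    (h : (symMatrixOfUpper x).PosDef) : gammaIntegrand p e x = ENNReal.ofReal
      (Real.exp (-(symMatrixOfUpper x).trace) * (symMatrixOfUpper x).det ^ e) :=
  Set.indicator_of_mem (s := {x | (symMatrixOfUpper x).PosDef}) h _

theorem gammaIntegrand_of_not_posDef {p : ℕ} (e : ℝ) {x : UpperIdx p → ℝ}
    (h : ¬(symMatrixOfUpper x).PosDef) : gammaIntegrand p e x = 0 :=
  Set.indicator_of_notMem (s := {x | (symMatrixOfUpper x).PosDef}) h _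

theorem measurable_gammaIntegrand (p : ℕ) (e : ℝ) : Measurable (gammaIntegrand p e) := by
  refine Measurable.indicator ?_ (measurableSet_posDef_symMatrixOfUpper p)
  have h1 := (continuous_symMatrixOfUpper p).matrix_det.measurable
  have h2 := (continuous_symMatrixOfUpper p).matrix_trace.measurable
  fun_prop

/-- With corner `c`, first row `v` and Schur complement `B`, the determinant is `c |B|` and the
trace is `c + |v|² / c + tr B`, so the integrand factors. -/
theorem gammaIntegrand_succ {p : ℕ} (e : ℝ) (x : UpperIdx (p + 1) → ℝ) :
    gammaIntegrand (p + 1) e x = (Set.Ioi 0).indicator (fun c : ℝ =>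
      ENNReal.ofReal (Real.exp (-c) * c ^ e) *
        (ENNReal.ofReal (Real.exp (-c⁻¹ * ∑ j, (splitUpper x).2.1 j ^ 2)) *
        gammaIntegrand p e ((splitUpper x).2.2 -
          fun ij => (splitUpper x).2.1 ij.1.1 * (splitUpper x).2.1 ij.1.2 / c)))
      (splitUpper x).1 := by
  have hS := schurCompl_symMatrixOfUpper x
  have hPD := posDef_iff_schurCompl (symMatrixOfUpper_isSymm x)
  rw [hS, symMatrixOfUpper_zero_zero] at hPD
  by_cases hc : 0 < (splitUpper x).1
  swap
  · rw [gammaIntegrand_of_not_posDef e fun h => hc (hPD.1 h).1,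
      Set.indicator_of_notMem (by simpa using hc)]
  rw [Set.indicator_of_mem (Set.mem_Ioi.2 hc)]
  by_cases hB : (symMatrixOfUpper ((splitUpper x).2.2 - fun ij =>
      (splitUpper x).2.1 ij.1.1 * (splitUpper x).2.1 ij.1.2 / (splitUpper x).1)).PosDef
  swap
  · rw [gammaIntegrand_of_not_posDef e fun h => hB (hPD.1 h).2,
      gammaIntegrand_of_not_posDef e hB, mul_zero, mul_zero]
  rw [gammaIntegrand_of_posDef e (hPD.2 ⟨hc, hB⟩), gammaIntegrand_of_posDef e hB,
    ← ENNReal.ofReal_mul (by positivity), ← ENNReal.ofReal_mul (by positivity)]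
  congr 1
  rw [det_eq_mul_det_schurCompl _ (by rw [symMatrixOfUpper_zero_zero]; exact hc.ne'), hS,
    symMatrixOfUpper_zero_zero, Real.mul_rpow hc.le hB.det_pos.le, trace_symMatrixOfUpper_succ]
  have htr : (symMatrixOfUpper ((splitUpper x).2.2 - fun ij =>
      (splitUpper x).2.1 ij.1.1 * (splitUpper x).2.1 ij.1.2 / (splitUpper x).1)).trace =
      (symMatrixOfUpper (splitUpper x).2.2).trace -
        (splitUpper x).1⁻¹ * ∑ j, (splitUpper x).2.1 j ^ 2 := by
    simp only [Matrix.trace, Matrix.diag_apply, symMatrixOfUpper, Matrix.of_apply, Pi.sub_apply,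
      Finset.sum_sub_distrib, Finset.mul_sum, min_self, max_self]
    congr 1
    exact Finset.sum_congr rfl fun j _ => by ring
  have hexp : Real.exp (-((splitUpper x).1 + (symMatrixOfUpper (splitUpper x).2.2).trace)) =
      Real.exp (-(splitUpper x).1) *
        (Real.exp (-(splitUpper x).1⁻¹ * ∑ j, (splitUpper x).2.1 j ^ 2) *
        Real.exp (-((symMatrixOfUpper (splitUpper x).2.2).trace -
          (splitUpper x).1⁻¹ * ∑ j, (splitUpper x).2.1 j ^ 2))) := by
    rw [← Real.exp_add, ← Real.exp_add]
    ring_nf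
  rw [htr, hexp]
  ring

/-- Translation removes the shift in the lower block, the Gaussian integral in the first row gives
`(π c) ^ (p / 2)`, and the corner then contributes a gamma integral. The exponent `e` of the
determinant does not change with the size, hence the parametrisation by `e` instead of `a`. -/
theorem lintegral_gammaIntegrand_succ (p : ℕ) {e : ℝ} (he : 0 < e + 1) :
    ∫⁻ x, gammaIntegrand (p + 1) e x =
      ENNReal.ofReal (Real.pi ^ ((p : ℝ) / 2) * Real.Gamma (e + (p : ℝ) / 2 + 1)) *
        ∫⁻ y, gammaIntegrand p e y := by
  have hg := measurable_gammaIntegrand p e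
  set F : ℝ × (Fin p → ℝ) × (UpperIdx p → ℝ) → ENNReal := fun z =>
    (Set.Ioi (0 : ℝ)).indicator (fun c : ℝ => ENNReal.ofReal (Real.exp (-c) * c ^ e) *
      (ENNReal.ofReal (Real.exp (-c⁻¹ * ∑ j, z.2.1 j ^ 2)) *
        gammaIntegrand p e (z.2.2 - fun ij => z.2.1 ij.1.1 * z.2.1 ij.1.2 / c))) z.1 with hF
  have hFm : Measurable F := by
    have : F = ((Set.Ioi (0 : ℝ)) ×ˢ Set.univ).indicator fun z =>
        ENNReal.ofReal (Real.exp (-z.1) * z.1 ^ e) *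
        (ENNReal.ofReal (Real.exp (-z.1⁻¹ * ∑ j, z.2.1 j ^ 2)) *
          gammaIntegrand p e (z.2.2 - fun ij => z.2.1 ij.1.1 * z.2.1 ij.1.2 / z.1)) := by
      ext z
      by_cases hz : 0 < z.1 <;> simp [hF, Set.indicator, hz]
    rw [this]
    refine Measurable.indicator ?_ (measurableSet_Ioi.prod MeasurableSet.univ)
    refine Measurable.mul (by fun_prop) (Measurable.mul (by fun_prop) (hg.comp ?_))
    fun_prop
  have step : ∀ c ∈ Set.Ioi (0 : ℝ), ∫⁻ z : (Fin p → ℝ) × (UpperIdx p → ℝ), F (c, z) =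
      ENNReal.ofReal (Real.pi ^ ((p : ℝ) / 2)) *
        ENNReal.ofReal (Real.exp (-c) * c ^ (e + (p : ℝ) / 2 + 1 - 1)) *
          ∫⁻ y, gammaIntegrand p e y := by
    intro c hc
    have hc' : 0 < c := hc
    rw [Measure.volume_eq_prod, lintegral_prod (fun z => F (c, z)) (hFm.comp measurable_prodMk_left).aemeasurable]
    simp only [hF, Set.indicator_of_mem hc]
    have inner : ∀ v : Fin p → ℝ, ∫⁻ y, ENNReal.ofReal (Real.exp (-c) * c ^ e) *
        (ENNReal.ofReal (Real.exp (-c⁻¹ * ∑ j, v j ^ 2)) *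
          gammaIntegrand p e (y - fun ij => v ij.1.1 * v ij.1.2 / c)) =
        ENNReal.ofReal (Real.exp (-c) * c ^ e) *
          ((∫⁻ y, gammaIntegrand p e y) * ENNReal.ofReal (Real.exp (-c⁻¹ * ∑ j, v j ^ 2))) := by
      intro v
      rw [lintegral_const_mul _ (by fun_prop), lintegral_const_mul _ (by fun_prop),
        lintegral_sub_right_eq_self (gammaIntegrand p e), mul_comm (ENNReal.ofReal (Real.exp _))]
    rw [lintegral_congr inner, lintegral_const_mul _ (by fun_prop),
      lintegral_const_mul _ (by fun_prop), lintegral_exp_neg_mul_sum_sq (inv_pos.2 hc'),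
      Fintype.card_fin, div_inv_eq_mul, Real.mul_rpow Real.pi_pos.le hc'.le, add_sub_cancel_right,
      Real.rpow_add hc', ENNReal.ofReal_mul (by positivity), ENNReal.ofReal_mul (by positivity),
      ENNReal.ofReal_mul (by positivity), ENNReal.ofReal_mul (by positivity)]
    ring
  have h0 : 0 < e + (p : ℝ) / 2 + 1 := by
    linarith [show (0 : ℝ) ≤ (p : ℝ) / 2 by positivity]
  calc ∫⁻ x, gammaIntegrand (p + 1) e x = ∫⁻ x, F (splitUpper x) :=
        lintegral_congr fun x => gammaIntegrand_succ e x
    _ = ∫⁻ z, F z := (measurePreserving_splitUpper p).lintegral_comp hFm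
    _ = ∫⁻ c, ∫⁻ z, F (c, z) := by rw [Measure.volume_eq_prod, lintegral_prod _ hFm.aemeasurable]
    _ = ∫⁻ c in Set.Ioi 0, ∫⁻ z, F (c, z) := by
        rw [← lintegral_indicator measurableSet_Ioi]
        refine lintegral_congr fun c => ?_
        by_cases hc : 0 < c
        · rw [Set.indicator_of_mem (Set.mem_Ioi.2 hc)]
        · rw [Set.indicator_of_notMem (by simpa using hc)]
          simp [hF, hc]
    _ = _ := by
        rw [setLIntegral_congr_fun measurableSet_Ioi step, lintegral_mul_const _ (by fun_prop),
          lintegral_const_mul _ (by fun_prop), ENNReal.ofReal_mul (by positivity),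
          Real.Gamma_eq_integral h0, ofReal_integral_eq_lintegral_ofReal
            (Real.GammaIntegral_convergent h0)]
        filter_upwards [ae_restrict_mem measurableSet_Ioi] with c hc
        have hc : 0 < c := hc
        positivity

theorem lintegral_gammaIntegrand (p : ℕ) {e : ℝ} (he : 0 < e + 1) :
    ∫⁻ x, gammaIntegrand p e x = ENNReal.ofReal (∏ j ∈ Finset.range p,
      (Real.pi ^ ((j : ℝ) / 2) * Real.Gamma (e + (j : ℝ) / 2 + 1))) := by
  induction p with
  | zero =>
    have h0 (x : UpperIdx 0 → ℝ) : (symMatrixOfUpper x).PosDef :=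
      Matrix.PosDef.of_dotProduct_mulVec_pos (by ext i; exact i.elim0)
        fun y hy => absurd (Subsingleton.elim y 0) hy
    rw [lintegral_unique, gammaIntegrand_of_posDef e (h0 _)]
    simp [volume_pi, Matrix.trace]
  | succ p ih =>
    rw [lintegral_gammaIntegrand_succ p he, ih, Finset.prod_range_succ, mul_comm,
      ← ENNReal.ofReal_mul]
    refine Finset.prod_nonneg fun j _ => ?_
    have : 0 < e + (j : ℝ) / 2 + 1 := by linarith [show (0 : ℝ) ≤ (j : ℝ) / 2 by positivity]
    have := Real.Gamma_pos_of_pos this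
    positivity

theorem multivariateGamma_eq_prod (p : ℕ) {a : ℝ} (ha : ((p : ℝ) - 1) / 2 < a) :
    multivariateGamma p a = (∏ j ∈ Finset.range p, Real.pi ^ ((j : ℝ) / 2)) *
      ∏ j ∈ Finset.range p, Real.Gamma (a - (j : ℝ) / 2) := by
  have he : 0 < a - ((p : ℝ) + 1) / 2 + 1 := by linarith
  have hS := measurableSet_posDef_symMatrixOfUpper p
  have hm : Measurable fun x : UpperIdx p → ℝ => Real.exp (-(symMatrixOfUpper x).trace) *
      (symMatrixOfUpper x).det ^ (a - ((p : ℝ) + 1) / 2) := by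
    have h1 := (continuous_symMatrixOfUpper p).matrix_det.measurable
    have h2 := (continuous_symMatrixOfUpper p).matrix_trace.measurable
    fun_prop
  have h := lintegral_gammaIntegrand p he
  unfold gammaIntegrand at h
  rw [lintegral_indicator hS] at h
  rw [multivariateGamma, integral_eq_lintegral_of_nonneg_ae _ hm.aestronglyMeasurable, h,
    ENNReal.toReal_ofReal, Finset.prod_mul_distrib]
  · congr 1
    -- The two products run in opposite orders: for `e = a - (p + 1) / 2`, `e + j / 2 + 1 = a - (p -
    -- 1 - j) / 2`.
    rw [← Finset.prod_range_reflect]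
    refine Finset.prod_congr rfl fun j hj => ?_
    rw [Nat.cast_sub (by have := Finset.mem_range.1 hj; omega), Nat.cast_sub (by
      have := Finset.mem_range.1 hj; omega)]
    push_cast
    congr 1
    ring
  · refine Finset.prod_nonneg fun j _ => ?_
    have : 0 < a - ((p : ℝ) + 1) / 2 + (j : ℝ) / 2 + 1 := by
      linarith [show (0 : ℝ) ≤ (j : ℝ) / 2 by positivity]
    have := Real.Gamma_pos_of_pos this
    positivity
  · filter_upwards [ae_restrict_mem hS] with x hx
    have := hx.det_pos
    exact mul_nonneg (Real.exp_nonneg _) (Real.rpow_nonneg this.le _)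

/-! ### The matrix of sums of squares and products as a quadratic expression in the sample. -/

/-- The projection onto the vectors with coordinates of sum zero. -/
noncomputable def centering (n : ℕ) : Matrix (Fin n) (Fin n) ℝ := deflate 1 1

theorem one_dotProduct_one_mulVec_one (n : ℕ) :
    (1 : Fin n → ℝ) ⬝ᵥ ((1 : Matrix (Fin n) (Fin n) ℝ) *ᵥ 1) = n := by
  simp

theorem centering_isSymm (n : ℕ) : (centering n).IsSymm :=
  deflate_isSymm Matrix.isSymm_one

theorem centering_mul_self {n : ℕ} (hn : n ≠ 0) : centering n * centering n = centering n :=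
  deflate_mul_self Matrix.isSymm_one (Matrix.one_mul 1) (by
    rw [one_dotProduct_one_mulVec_one]; exact_mod_cast hn)

theorem centering_trace {n : ℕ} (hn : n ≠ 0) : (centering n).trace = n - 1 := by
  rw [centering, deflate_trace Matrix.isSymm_one (Matrix.one_mul 1) (by
    rw [one_dotProduct_one_mulVec_one]; exact_mod_cast hn)]
  simp

theorem centering_mul_apply {n p : ℕ} (x : Fin n → Fin p → ℝ) (i : Fin n) (a : Fin p) :
    (centering n * Matrix.of x) i a = (x i - sampleMean x) a := by
  rw [centering, deflate, one_dotProduct_one_mulVec_one, Matrix.one_mulVec, Matrix.sub_mul,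
    Matrix.one_mul, Matrix.smul_mul]
  simp [sampleMean, Matrix.mul_apply, Finset.sum_apply]

/-- Centering is a symmetric projection, so the Gram matrix of the centered data needs only one
factor `centering n`. -/
theorem sspMatrix_eq {n p : ℕ} (hn : n ≠ 0) (x : Fin n → Fin p → ℝ) :
    sspMatrix x = (Matrix.of x)ᵀ * centering n * Matrix.of x := by
  have h : (Matrix.of x)ᵀ * centering n * Matrix.of x =
      (centering n * Matrix.of x)ᵀ * (centering n * Matrix.of x) := by
    rw [Matrix.transpose_mul, (centering_isSymm n).eq, Matrix.mul_assoc, Matrix.mul_assoc,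
      ← Matrix.mul_assoc (centering n), centering_mul_self hn]
  rw [h]
  ext a b
  rw [Matrix.mul_apply]
  simp only [Matrix.transpose_apply, centering_mul_apply]
  simp [sspMatrix, Matrix.sum_apply, Matrix.vecMulVec_apply]

theorem det_sspMatrix_nonneg {n p : ℕ} (hn : n ≠ 0) (x : Fin n → Fin p → ℝ) :
    0 ≤ (sspMatrix x).det := by
  rw [sspMatrix_eq hn]
  exact det_transpose_mul_mul_nonneg (centering_isSymm n) (centering_mul_self hn) _

theorem measurable_det_sspMatrix {n p : ℕ} (hn : n ≠ 0) :
    Measurable fun x : Fin n → Fin p → ℝ => (sspMatrix x).det := by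
  simp_rw [sspMatrix_eq hn]
  exact measurable_det_transpose_mul_mul _

theorem sspMatrix_add_const {n p : ℕ} (hn : n ≠ 0) (x : Fin n → Fin p → ℝ) (m : Fin p → ℝ) :
    sspMatrix (fun i => x i + m) = sspMatrix x := by
  have hn' : (n : ℝ) ≠ 0 := by exact_mod_cast hn
  have h : sampleMean (fun i => x i + m) = sampleMean x + m := by
    ext a
    simp [sampleMean, Finset.sum_add_distrib, mul_add, hn']
  simp [sspMatrix, h]

theorem sspMatrix_mulVec {n p : ℕ} (hn : n ≠ 0) (x : Fin n → Fin p → ℝ)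
    (L : Matrix (Fin p) (Fin p) ℝ) :
    sspMatrix (fun i => L *ᵥ x i) = L * sspMatrix x * Lᵀ := by
  have h : Matrix.of (fun i => L *ᵥ x i) = Matrix.of x * Lᵀ := by
    ext i a
    simp [Matrix.mulVec, Matrix.mul_apply, dotProduct, mul_comm]
  rw [sspMatrix_eq hn, sspMatrix_eq hn, h, Matrix.transpose_mul, Matrix.transpose_transpose]
  simp only [Matrix.mul_assoc]

theorem det_sspMatrix_smul {n p : ℕ} (hn : n ≠ 0) (x : Fin n → Fin p → ℝ) (r : ℝ) :
    (sspMatrix (r • x)).det = (r ^ 2) ^ p * (sspMatrix x).det := by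
  have h : Matrix.of (r • x) = r • Matrix.of x := rfl
  rw [sspMatrix_eq hn, sspMatrix_eq hn, h, Matrix.transpose_smul, Matrix.smul_mul, Matrix.smul_mul,
    Matrix.mul_smul, smul_smul, Matrix.det_smul, Fintype.card_fin, sq]

/-! ### Reduction to standard location and scale. -/

open scoped MatrixOrder in
theorem exists_eq_mul_transpose_of_posDef {p : ℕ} {S : Matrix (Fin p) (Fin p) ℝ} (hS : S.PosDef) :
    ∃ L : Matrix (Fin p) (Fin p) ℝ, S = L * Lᵀ := by
  obtain ⟨B, rfl⟩ := CStarAlgebra.nonneg_iff_eq_star_mul_self.mp hS.posSemidef.nonneg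
  exact ⟨Bᵀ, by
    rw [Matrix.transpose_transpose, Matrix.star_eq_conjTranspose,
      Matrix.conjTranspose_eq_transpose_of_trivial]⟩

/-- The map acts by `L` on each of the `card ι` vectors, so its determinant is a power of `L.det`.
-/
theorem lintegral_comp_mulVec_pi {ι κ : Type*} [Fintype ι] [Fintype κ] [DecidableEq κ]
    {L : Matrix κ κ ℝ} (hL : L.det ≠ 0) (f : (ι → κ → ℝ) → ENNReal) (hf : Measurable f) :
    ∫⁻ w : ι → κ → ℝ, f (fun i => L *ᵥ w i) =
      ENNReal.ofReal |(L.det ^ Fintype.card ι)⁻¹| * ∫⁻ x, f x := by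
  set T : (ι → κ → ℝ) →ₗ[ℝ] (ι → κ → ℝ) :=
    LinearMap.pi fun i => (Matrix.toLin' L).comp (LinearMap.proj i) with hT
  have hdet : LinearMap.det T = L.det ^ Fintype.card ι := by
    rw [hT, LinearMap.det_pi]
    simp
  have h := lintegral_map (μ := volume) hf (LinearMap.continuous_of_finiteDimensional T).measurable
  rw [Measure.map_linearMap_addHaar_eq_smul_addHaar _ (by rw [hdet]; exact pow_ne_zero _ hL),
    lintegral_smul_measure, smul_eq_mul, hdet] at h
  rw [h]
  rfl

/-- Reduction of the location and the scale matrix to the standard ones. -/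
theorem lintegral_det_sspMatrix_standardize {n p : ℕ} (hn : n ≠ 0) (m : Fin p → ℝ)
    {S : Matrix (Fin p) (Fin p) ℝ} (hS : S.PosDef) (t : ℝ) (k : ℝ → ENNReal) (hk : Measurable k) :
    ENNReal.ofReal (1 / S.det ^ ((n : ℝ) / 2)) * ∫⁻ x : Fin n → Fin p → ℝ,
        ENNReal.ofReal ((sspMatrix x).det ^ t) * k (∑ i, (x i - m) ⬝ᵥ (S⁻¹ *ᵥ (x i - m))) =
      ENNReal.ofReal (S.det ^ t) * ∫⁻ x : Fin n → Fin p → ℝ,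
        ENNReal.ofReal ((sspMatrix x).det ^ t) * k (∑ i, ∑ j, x i j ^ 2) := by
  have hSd := hS.det_pos
  obtain ⟨L, rfl⟩ := exists_eq_mul_transpose_of_posDef hS
  have hdet : (L * Lᵀ).det = L.det ^ 2 := by rw [Matrix.det_mul, Matrix.det_transpose, sq]
  have hL : L.det ≠ 0 := fun h => by simp [hdet, h] at hSd
  have hquad : ∀ w : Fin p → ℝ, (L *ᵥ w) ⬝ᵥ ((L * Lᵀ)⁻¹ *ᵥ (L *ᵥ w)) = ∑ j, w j ^ 2 := by
    intro w
    have hu : IsUnit L.det := isUnit_iff_ne_zero.2 hL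
    have hu' : IsUnit (Lᵀ).det := by rwa [Matrix.det_transpose]
    have e : (L * Lᵀ)⁻¹ *ᵥ (L *ᵥ w) = (Lᵀ)⁻¹ *ᵥ w := by
      rw [Matrix.mulVec_mulVec, Matrix.mul_inv_rev, Matrix.mul_assoc, Matrix.nonsing_inv_mul _ hu,
        Matrix.mul_one]
    rw [e, ← Matrix.vecMul_transpose, ← Matrix.dotProduct_mulVec, Matrix.mulVec_mulVec,
      Matrix.mul_nonsing_inv _ hu', Matrix.one_mulVec]
    simp [dotProduct, sq]
  have hdm := measurable_det_sspMatrix (p := p) hn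
  set f : (Fin n → Fin p → ℝ) → ENNReal := fun x => ENNReal.ofReal ((sspMatrix x).det ^ t) *
    k (∑ i, x i ⬝ᵥ ((L * Lᵀ)⁻¹ *ᵥ x i)) with hf
  have hfm : Measurable f := by
    refine Measurable.mul (by fun_prop) (hk.comp ?_)
    unfold dotProduct Matrix.mulVec dotProduct
    fun_prop
  have hshift : ∫⁻ x : Fin n → Fin p → ℝ, ENNReal.ofReal ((sspMatrix x).det ^ t) *
      k (∑ i, (x i - m) ⬝ᵥ ((L * Lᵀ)⁻¹ *ᵥ (x i - m))) = ∫⁻ x, f x := by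
    rw [← lintegral_add_right_eq_self _ (fun _ : Fin n => m)]
    refine lintegral_congr fun x => ?_
    have : sspMatrix (x + fun _ => m) = sspMatrix x := sspMatrix_add_const hn x m
    rw [this]
    simp [hf]
  -- The normalising power of the density is exactly the Jacobian of `w ↦ L w` on all `n` vectors.
  have hconst : 1 / (L * Lᵀ).det ^ ((n : ℝ) / 2) = |(L.det ^ Fintype.card (Fin n))⁻¹| := by
    rw [hdet, ← sq_abs, ← Real.rpow_natCast, ← Real.rpow_mul (abs_nonneg _), Fintype.card_fin,
      abs_inv, abs_pow, one_div, ← Real.rpow_natCast]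
    congr 2
    push_cast
    ring
  rw [hshift, hconst, ← lintegral_comp_mulVec_pi hL f hfm, ← lintegral_const_mul _ (by
    exact Measurable.mul (by fun_prop) (hk.comp (by fun_prop)))]
  refine lintegral_congr fun w => ?_
  simp only [hf, hquad]
  have h1 : (sspMatrix fun i => L *ᵥ w i).det = (L * Lᵀ).det * (sspMatrix w).det := by
    rw [sspMatrix_mulVec hn, Matrix.det_mul, Matrix.det_mul, Matrix.det_mul]
    ring
  rw [h1, Real.mul_rpow hSd.le (det_sspMatrix_nonneg hn w), ENNReal.ofReal_mul (by positivity),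
    mul_assoc]

/-! ### Gaussian moments, Kotz moments and the conclusion. -/

/-- The moments of the determinant of the matrix of sums of squares and products of a Gaussian
sample. -/
theorem lintegral_det_sspMatrix_gaussian {n p : ℕ} (hn : p < n) {t : ℝ} (ht : 0 < t) :
    ∫⁻ x : Fin n → Fin p → ℝ, ENNReal.ofReal ((sspMatrix x).det ^ t) *
        ENNReal.ofReal (Real.exp (-∑ i, ∑ j, x i j ^ 2)) =
      ENNReal.ofReal (Real.pi ^ ((n : ℝ) * p / 2) * (multivariateGamma p (((n : ℝ) - 1) / 2 + t) /
        multivariateGamma p (((n : ℝ) - 1) / 2))) := by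
  have hn0 : n ≠ 0 := by omega
  have hpn : (p : ℝ) + 1 ≤ n := by exact_mod_cast hn
  -- Centering leaves `n - 1` degrees of freedom, and `p ≤ n - 1` is the hypothesis `p < n`.
  have h := lintegral_det_rpow_mul_exp_neg ht p (centering n) (n - 1) (centering_isSymm n)
    (centering_mul_self hn0) (by
      rw [centering_trace hn0, Nat.cast_sub (by omega), Nat.cast_one]) (by omega)
  rw [Fintype.card_fin, Nat.cast_sub (by omega), Nat.cast_one] at h
  rw [multivariateGamma_eq_prod p (by linarith), multivariateGamma_eq_prod p (by linarith),
    mul_div_mul_left _ _ (Finset.prod_pos fun j _ => by positivity).ne', ← Finset.prod_div_distrib]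
  have e : ∀ j : ℕ, ((n : ℝ) - 1) / 2 + t - (j : ℝ) / 2 = ((n : ℝ) - 1 - j) / 2 + t ∧
      ((n : ℝ) - 1) / 2 - (j : ℝ) / 2 = ((n : ℝ) - 1 - j) / 2 := fun j => ⟨by ring, by ring⟩
  simp only [e]
  rw [← h]
  refine lintegral_congr fun x => ?_
  rw [ENNReal.ofReal_mul (Real.rpow_nonneg (det_transpose_mul_mul_nonneg (centering_isSymm n)
    (centering_mul_self hn0) _) _), sspMatrix_eq hn0]

theorem multivariateGamma_pos (p : ℕ) {a : ℝ} (ha : ((p : ℝ) - 1) / 2 < a) :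
    0 < multivariateGamma p a := by
  rw [multivariateGamma_eq_prod p ha]
  refine mul_pos (Finset.prod_pos fun j _ => by positivity) (Finset.prod_pos fun j hj => ?_)
  have : (j : ℝ) + 1 ≤ p := by exact_mod_cast Finset.mem_range.1 hj
  exact Real.Gamma_pos_of_pos (by linarith)

/-- The moments of the determinant for a standard density proportional to
`z ^ (q - 1) * exp (-θ z ^ s)`. -/
theorem lintegral_det_sspMatrix_kotz {n p : ℕ} (hp : 1 ≤ p) (hn : p < n) {q θ s t : ℝ}
    (hθ : 0 < θ) (hs : 0 < s) (hq : 2 < 2 * q + n * p) (ht : 0 < t) :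
    ∫⁻ x : Fin n → Fin p → ℝ, ENNReal.ofReal ((sspMatrix x).det ^ t) *
        ENNReal.ofReal ((∑ i, ∑ j, x i j ^ 2) ^ (q - 1) *
          Real.exp (-θ * (∑ i, ∑ j, x i j ^ 2) ^ s)) =
      ENNReal.ofReal (Real.pi ^ ((n : ℝ) * p / 2) * (multivariateGamma p (((n : ℝ) - 1) / 2 + t) /
        multivariateGamma p (((n : ℝ) - 1) / 2)) *
        (θ ^ (-(2 * q + n * p + 2 * t * p - 2) / (2 * s)) / s *
          Real.Gamma ((2 * q + n * p + 2 * t * p - 2) / (2 * s))) /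
          Real.Gamma ((n * p + 2 * t * p) / 2)) := by
  have hn0 : n ≠ 0 := by omega
  have hp0 : (0 : ℝ) < p := by exact_mod_cast hp
  have hnr : (0 : ℝ) < n := by exact_mod_cast Nat.pos_of_ne_zero hn0
  have hpn : (p : ℝ) + 1 ≤ n := by exact_mod_cast hn
  have : Nonempty (Fin n) := ⟨⟨0, by omega⟩⟩
  have : Nonempty (Fin p) := ⟨⟨0, by omega⟩⟩
  have hdm := measurable_det_sspMatrix (p := p) hn0
  obtain ⟨C, hC⟩ := exists_lintegral_homogeneous_mul (volume : Measure (Fin n → Fin p → ℝ))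
    (fun x => ENNReal.ofReal ((sspMatrix x).det ^ t)) (by fun_prop) (2 * p * t) (by
      intro r x hr
      rw [det_sspMatrix_smul hn0, Real.mul_rpow (by positivity) (det_sspMatrix_nonneg hn0 x),
        ENNReal.ofReal_mul (by positivity), ← pow_mul, ← Real.rpow_natCast,
        ← Real.rpow_mul hr.le]
      push_cast
      rfl) (fun x => ∑ i, ∑ j, x i j ^ 2) (by fun_prop) (by
      intro x hx
      obtain ⟨i, hi⟩ := Function.ne_iff.1 hx
      obtain ⟨j, hj⟩ := Function.ne_iff.1 hi
      have hj : x i j ≠ 0 := hj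
      refine Finset.sum_pos' (fun i _ => Finset.sum_nonneg fun j _ => sq_nonneg _)
        ⟨i, Finset.mem_univ i, Finset.sum_pos' (fun j _ => sq_nonneg _)
          ⟨j, Finset.mem_univ j, by positivity⟩⟩) (by
      intro r x
      simp [mul_pow, Finset.mul_sum])
  have hdim : Module.finrank ℝ (Fin n → Fin p → ℝ) = n * p := by
    simp [Module.finrank_pi_fintype]
  rw [hdim] at hC
  push_cast at hC
  have htp : 0 < t * p := mul_pos ht hp0
  have hnp : 0 < (n : ℝ) * p := mul_pos hnr hp0
  -- The Gaussian case `q = θ = s = 1`, whose left side is already known; it eliminates the constant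
  -- `C`.
  have hG := hC (fun z => ENNReal.ofReal (z ^ ((1 : ℝ) - 1) * Real.exp (-1 * z ^ (1 : ℝ))))
    (by fun_prop)
  rw [lintegral_Ioi_rpow_mul_exp_neg_mul_rpow one_pos one_pos (by nlinarith)] at hG
  simp only [sub_self, Real.rpow_zero, one_mul, neg_mul, Real.rpow_one, Real.one_rpow, mul_one] at hG
  rw [lintegral_det_sspMatrix_gaussian hn ht] at hG
  have hK := hC (fun z => ENNReal.ofReal (z ^ (q - 1) * Real.exp (-θ * z ^ s))) (by fun_prop)
  rw [lintegral_Ioi_rpow_mul_exp_neg_mul_rpow hθ hs (by nlinarith)] at hK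
  rw [hK]
  have e1 : (n : ℝ) * p - 1 + 2 * p * t + 2 - 1 = n * p + 2 * t * p := by ring
  have e2 : (n : ℝ) * p - 1 + 2 * p * t + 2 * q - 1 = 2 * q + n * p + 2 * t * p - 2 := by ring
  rw [e1] at hG
  rw [e2]
  have hΓ : 0 < Real.Gamma (((n : ℝ) * p + 2 * t * p) / 2) := Real.Gamma_pos_of_pos (by linarith)
  have hM1 := multivariateGamma_pos p (a := ((n : ℝ) - 1) / 2 + t) (by linarith)
  have hM2 := multivariateGamma_pos p (a := ((n : ℝ) - 1) / 2) (by linarith)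
  set A : ℝ := Real.pi ^ ((n : ℝ) * p / 2) * (multivariateGamma p (((n : ℝ) - 1) / 2 + t) /
    multivariateGamma p (((n : ℝ) - 1) / 2)) with hA
  have hApos : 0 ≤ A := by positivity
  rw [mul_div_assoc, ENNReal.ofReal_mul hApos, hG, mul_assoc C, ← ENNReal.ofReal_mul (by positivity)]
  congr 2
  field_simp

theorem mainTheorem8 {Ω : Type*} [MeasurableSpace Ω] (P : Measure Ω) [IsProbabilityMeasure P]
    (n p : ℕ) (hp : 1 ≤ p) (hn : p < n)
    (q θ s : ℝ) (hθ : 0 < θ) (hs : 0 < s) (hq : 2 < 2 * q + n * p)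
    (m : Fin p → ℝ) (S : Matrix (Fin p) (Fin p) ℝ) (hS : S.PosDef)
    (X : Fin n → Ω → Fin p → ℝ) (hX : IsKotzModel P q θ s m S X)
    (t : ℝ) (ht : 0 < t) :
    Integrable (fun ω => (sspMatrix fun i => X i ω).det ^ t) P ∧
      ∫ ω, (sspMatrix fun i => X i ω).det ^ t ∂P =
        (θ ^ (-(t * p) / s) * Real.Gamma ((2 * q + n * p + 2 * t * p - 2) / (2 * s)) *
            Real.Gamma (n * p / 2) * multivariateGamma p (((n : ℝ) - 1) / 2 + t)) /
          (Real.Gamma ((2 * q + n * p - 2) / (2 * s)) *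
            Real.Gamma ((n * p + 2 * t * p) / 2) * multivariateGamma p (((n : ℝ) - 1) / 2)) *
          S.det ^ t := by
  have hn0 : n ≠ 0 := by omega
  have hp0 : (0 : ℝ) < p := by exact_mod_cast hp
  have hnr : (0 : ℝ) < n := by exact_mod_cast Nat.pos_of_ne_zero hn0
  have hpn : (p : ℝ) + 1 ≤ n := by exact_mod_cast hn
  have hnp : 0 < (p : ℝ) * n := mul_pos hp0 hnr
  have htp : 0 < t * p := mul_pos ht hp0
  have hSd := hS.det_pos
  have hdm := measurable_det_sspMatrix (p := p) hn0
  have hXm : AEMeasurable (fun ω i => X i ω) P := aemeasurable_pi_lambda _ hX.aemeasurable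
  have hΓ1 : 0 < Real.Gamma ((2 * q + p * n - 2) / (2 * s)) :=
    Real.Gamma_pos_of_pos (div_pos (by linarith) (by linarith))
  have hΓ2 : 0 < Real.Gamma (((p : ℝ) * n) / 2) := Real.Gamma_pos_of_pos (by linarith)
  have hΓ3 : 0 < Real.Gamma (((p : ℝ) * n + 2 * t * p) / 2) := Real.Gamma_pos_of_pos (by linarith)
  have hΓ4 : 0 < Real.Gamma ((2 * q + p * n + 2 * t * p - 2) / (2 * s)) :=
    Real.Gamma_pos_of_pos (div_pos (by linarith) (by linarith))
  have hM1 := multivariateGamma_pos p (a := ((n : ℝ) - 1) / 2 + t) (by linarith)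
  have hM2 := multivariateGamma_pos p (a := ((n : ℝ) - 1) / 2) (by linarith)
  set c : ℝ := s * θ ^ ((2 * q + p * n - 2) / (2 * s)) * Real.Gamma (p * n / 2) /
      (Real.pi ^ ((p * n : ℝ) / 2) * Real.Gamma ((2 * q + p * n - 2) / (2 * s))) with hc
  have hcpos : 0 < c := by positivity
  have hdens : Measurable fun x : Fin n → Fin p → ℝ =>
      ENNReal.ofReal (kotzDensity q θ s m S x) := by
    unfold kotzDensity kotzGenerator dotProduct Matrix.mulVec dotProduct
    fun_prop
  have hΦ : Measurable fun x : Fin n → Fin p → ℝ => ENNReal.ofReal ((sspMatrix x).det ^ t) := by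
    fun_prop
  have hred := lintegral_det_sspMatrix_standardize hn0 m hS t
    (fun z => ENNReal.ofReal (z ^ (q - 1) * Real.exp (-θ * z ^ s))) (by fun_prop)
  beta_reduce at hred
  -- Working with the lower integral of a nonnegative function yields integrability and the value
  -- together.
  have key : ∫⁻ ω, ENNReal.ofReal ((sspMatrix fun i => X i ω).det ^ t) ∂P =
      ENNReal.ofReal ((θ ^ (-(t * p) / s) *
            Real.Gamma ((2 * q + n * p + 2 * t * p - 2) / (2 * s)) *
            Real.Gamma (n * p / 2) * multivariateGamma p (((n : ℝ) - 1) / 2 + t)) /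
          (Real.Gamma ((2 * q + n * p - 2) / (2 * s)) *
            Real.Gamma ((n * p + 2 * t * p) / 2) * multivariateGamma p (((n : ℝ) - 1) / 2)) *
          S.det ^ t) := by
    calc ∫⁻ ω, ENNReal.ofReal ((sspMatrix fun i => X i ω).det ^ t) ∂P
        = ∫⁻ x, ENNReal.ofReal ((sspMatrix x).det ^ t) ∂(P.map fun ω i => X i ω) :=
          (lintegral_map' (f := fun x : Fin n → Fin p → ℝ =>
            ENNReal.ofReal ((sspMatrix x).det ^ t)) hΦ.aemeasurable hXm).symm
      _ = ∫⁻ x : Fin n → Fin p → ℝ, ENNReal.ofReal (kotzDensity q θ s m S x) *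
            ENNReal.ofReal ((sspMatrix x).det ^ t) := by
          rw [hX.map_eq, lintegral_withDensity_eq_lintegral_mul _ hdens (by fun_prop)]
          rfl
      _ = ENNReal.ofReal c * (ENNReal.ofReal (1 / S.det ^ ((n : ℝ) / 2)) *
            ∫⁻ x : Fin n → Fin p → ℝ, ENNReal.ofReal ((sspMatrix x).det ^ t) *
              ENNReal.ofReal ((∑ i, (x i - m) ⬝ᵥ (S⁻¹ *ᵥ (x i - m))) ^ (q - 1) *
                Real.exp (-θ * (∑ i, (x i - m) ⬝ᵥ (S⁻¹ *ᵥ (x i - m))) ^ s))) := by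
          have hm : Measurable fun x : Fin n → Fin p → ℝ =>
              ENNReal.ofReal ((sspMatrix x).det ^ t) *
              ENNReal.ofReal ((∑ i, (x i - m) ⬝ᵥ (S⁻¹ *ᵥ (x i - m))) ^ (q - 1) *
                Real.exp (-θ * (∑ i, (x i - m) ⬝ᵥ (S⁻¹ *ᵥ (x i - m))) ^ s)) := by
            unfold dotProduct Matrix.mulVec dotProduct
            fun_prop
          rw [← lintegral_const_mul _ hm, ← lintegral_const_mul _ (hm.const_mul _)]
          refine lintegral_congr fun x => ?_
          rw [kotzDensity, kotzGenerator, ← hc, ENNReal.ofReal_mul (by positivity), mul_assoc c,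
            ENNReal.ofReal_mul hcpos.le]
          ring
      _ = _ := by
          rw [hred, lintegral_det_sspMatrix_kotz hp hn hθ hs hq ht, ← ENNReal.ofReal_mul (by positivity),
            ← ENNReal.ofReal_mul hcpos.le]
          congr 1
          -- The power of `θ` from the normalising constant combines with that of the radial
          -- integral.
          have e : θ ^ (-(t * p) / s) = θ ^ ((2 * q + p * n - 2) / (2 * s)) *
              θ ^ (-(2 * q + p * n + 2 * t * p - 2) / (2 * s)) := by
            rw [← Real.rpow_add hθ]
            congr 1
            field_simp
            ring
          rw [hc, mul_comm (n : ℝ) (p : ℝ), e]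
          have hθ1 : 0 < θ ^ ((2 * q + p * n - 2) / (2 * s)) := by positivity
          have hπ : 0 < Real.pi ^ ((p * n : ℝ) / 2) := by positivity
          field_simp
  have hnn : ∀ ω, 0 ≤ (sspMatrix fun i => X i ω).det ^ t := fun ω =>
    Real.rpow_nonneg (det_sspMatrix_nonneg hn0 _) _
  have hmeas : AEStronglyMeasurable (fun ω => (sspMatrix fun i => X i ω).det ^ t) P :=
    ((hdm.pow_const t).comp_aemeasurable hXm).aestronglyMeasurable
  refine ⟨⟨hmeas, ?_⟩, ?_⟩
  · rw [hasFiniteIntegral_iff_ofReal (Filter.Eventually.of_forall hnn), key]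
    exact ENNReal.ofReal_lt_top
  · rw [integral_eq_lintegral_of_nonneg_ae (Filter.Eventually.of_forall hnn) hmeas, key,
      ENNReal.toReal_ofReal]
    rw [mul_comm (n : ℝ) (p : ℝ)]
    positivity
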